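/- Let $R$ be a commutative ring with unit, let $u_1,u_2,\ldots$ be a finite or infinite sequence in $R$ such that each $u_i$ is a non-zero-divisor on $R/(u_1,\ldots,u_{i-1})$ (a regular sequence), let $I=(u_1,u_2,\ldots)$, and let $s\ge 1$. Let $\mathbf K_*=\Lambda_R(e_i : i\ge 1)$ be the Koszul complex, with $e_i$ in degree $1$ and with the differential $\mathrm d$ that is the antiderivation with $\mathrm d e_i=u_i$. For $k\ge 0$ let $\mathrm U^{(k)}$ be the free $R$-module on the formal monomials $\tilde u_{i_1}\cdots\tilde u_{i_k}$ of degree $k$, placed in homological degree $0$, and put $\mathbf Q^{(k)}_*=\mathbf K_*\otimes_R \mathrm U^{(k)}$ with differential $\mathrm d_{\mathbf Q}^{(k)}=\mathrm d\otimes 1$. Let $\partial^{(k+1)}\colon\mathbf Q^{(k)}_*\to\mathbf Q^{(k+1)}_{*-1}$ be the $R$-linear map $$\partial^{(k+1)}\bigl(e_{j_1}\cdots e_{j_n}\,\tilde u_{i_1}\cdots\tilde u_{i_k}\bigr)=\sum_{a=1}^{n}(-1)^{a-1}\,e_{j_1}\cdots\widehat{e_{j_a}}\cdots e_{j_n}\;\tilde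 u_{j_a}\tilde u_{i_1}\cdots\tilde u_{i_k}.$$ Let $\mathbf K(R;I^s)_*=\mathbf Q^{(0)}_*\oplus\cdots\oplus\mathbf Q^{(s-1)}_*$ with the differential $\mathrm d^{(s)}(x_0,\ldots,x_{s-1})=(x_0',\ldots,x_{s-1}')$, where $x_0'=\mathrm d_{\mathbf Q}^{(0)}x_0$ and $x_k'=\partial^{(k)}x_{k-1}+\mathrm d_{\mathbf Q}^{(k)}x_k$ for $1\le k\le s-1$. With the products $\mathbf Q^{(p)}_*\otimes\mathbf Q^{(q)}_*\to\mathbf Q^{(p+q)}_*$, $(x\tilde u)\otimes(y\tilde v)\mapsto (xy)\,\tilde u\tilde v$ (zero if $p+q\ge s$), this is a differential graded $R$-algebra. Then there is an isomorphism of graded $R/I$-algebras $$\mathrm{Tor}^R_*(R/I,R/I^s)\;\cong\;\mathrm H_*\bigl(R/I\otimes_R\mathbf K(R;I^s)_*,\;1\otimes\mathrm d^{(s)}\bigr),$$ that is, a degree-preserving isomorphism of $R/I$-modules that carries $1$ to $1$ and products to products. Here the product on $\mathrm{Tor}^R_*(R/I,R/I^s)=\mathrm H_*(R/I\otimes_R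 P_*)$, for a projective resolution $P_*$ of $R/I^s$ over $R$, is the one induced by the multiplication of $R/I$ and a chain map $P_*\otimes_R P_*\to P_*$ that lifts the multiplication of $R/I^s$. -/

import Mathlib

universe u v w

namespace RegularQuotient

noncomputable section

open scoped TensorProduct DirectSum

/-- A differential (homologically) graded algebra over a commutative ring `A`: an associative
unital `A`-algebra graded by `ℕ`, with an `A`-linear differential of degree `-1` that satisfies the
signed Leibniz rule. -/
structure DGAlg (A : Type u) [CommRing A] where
  /-- the underlying algebra (the sum of all degrees) -/
  carrier : Type v
  [ring : Ring carrier]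
  [algebra : Algebra A carrier]
  /-- the homogeneous parts -/
  deg : ℕ → Submodule A carrier
  [graded : GradedAlgebra deg]
  /-- the differential -/
  d : carrier →ₗ[A] carrier
  d_mem : ∀ n x, x ∈ deg (n + 1) → d x ∈ deg n
  d_deg_zero : ∀ x, x ∈ deg 0 → d x = 0
  d_d : ∀ x, d (d x) = 0
  leibniz : ∀ n x y, x ∈ deg n → d (x * y) = d x * y + (-1 : A) ^ n • (x * d y)

attribute [instance] DGAlg.ring DGAlg.algebra DGAlg.graded

namespace DGAlg

variable {A : Type u} [CommRing A] (E : DGAlg.{u, v} A)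

/-- The sign involution `x ↦ (-1)^|x| x`. -/
def sgn : E.carrier →ₗ[A] E.carrier :=
  (DirectSum.toModule A ℕ E.carrier fun n => (-1 : A) ^ n • (E.deg n).subtype) ∘ₗ
    (DirectSum.decomposeLinearEquiv E.deg).toLinearMap

lemma sgn_of_mem {n : ℕ} {x : E.carrier} (hx : x ∈ E.deg n) : E.sgn x = (-1 : A) ^ n • x := by
  simp only [sgn, LinearMap.comp_apply, LinearEquiv.coe_coe, DirectSum.decomposeLinearEquiv_apply]
  rw [DirectSum.decompose_of_mem _ hx]
  exact (DirectSum.toModule_lof A (M := fun i => E.deg i) n ⟨x, hx⟩)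

lemma sgn_sgn (x : E.carrier) : E.sgn (E.sgn x) = x := by
  induction x using DirectSum.Decomposition.inductionOn E.deg with
  | zero => simp
  | homogeneous m =>
    rw [E.sgn_of_mem m.2, map_smul, E.sgn_of_mem m.2, smul_smul, ← mul_pow]
    simp
  | add a b ha hb => simp [ha, hb]

lemma d_sgn (x : E.carrier) : E.d (E.sgn x) = - E.sgn (E.d x) := by
  induction x using DirectSum.Decomposition.inductionOn E.deg with
  | zero => simp
  | @homogeneous n m =>
    rw [E.sgn_of_mem m.2, map_smul]
    cases n with
    | zero => simp [E.d_deg_zero _ m.2]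
    | succ n => rw [E.sgn_of_mem (E.d_mem n _ m.2), pow_succ]; simp
  | add a b ha hb => simp [ha, hb]; abel

lemma d_mul (x y : E.carrier) : E.d (x * y) = E.d x * y + E.sgn x * E.d y := by
  induction x using DirectSum.Decomposition.inductionOn E.deg with
  | zero => simp
  | @homogeneous n m => rw [E.leibniz n _ _ m.2, E.sgn_of_mem m.2, smul_mul_assoc]
  | add a b ha hb => simp only [add_mul, map_add, ha, hb]; abel

/-- The subalgebra of cycles. -/
def cycles : Subalgebra A E.carrier where
  carrier := {x | E.d x = 0}
  mul_mem' {x y} hx hy := by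
    simp only [Set.mem_ofPred_eq] at *
    rw [E.d_mul, hx, hy]; simp
  add_mem' {x y} hx hy := by
    simp only [Set.mem_ofPred_eq] at *
    rw [map_add, hx, hy, add_zero]
  algebraMap_mem' r :=
    E.d_deg_zero _ (SetLike.algebraMap_mem_graded E.deg r)

lemma mem_cycles {x : E.carrier} : x ∈ E.cycles ↔ E.d x = 0 := Iff.rfl

/-- The two-sided ideal of boundaries in the algebra of cycles. -/
def boundaries : Ideal E.cycles where
  carrier := {z | ∃ w, E.d w = z}
  add_mem' := by
    rintro _ _ ⟨w, hw⟩ ⟨w', hw'⟩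
    exact ⟨w + w', by simp [hw, hw']⟩
  zero_mem' := ⟨0, by simp⟩
  smul_mem' := by
    rintro z b ⟨w, hw⟩
    refine ⟨E.sgn z * w, ?_⟩
    rw [E.d_mul, E.sgn_sgn, hw, E.d_sgn, E.mem_cycles.1 z.2]
    simp

instance : E.boundaries.IsTwoSided where
  mul_mem_of_left {a} b := by
    rintro ⟨w, hw⟩
    refine ⟨w * b, ?_⟩
    rw [E.d_mul, hw, E.mem_cycles.1 b.2]
    simp

/-- The homology algebra of a differential graded algebra. -/
abbrev Homology : Type v := E.cycles ⧸ E.boundaries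

/-- The homology classes of degree `n`. -/
def homologyDeg (n : ℕ) : Submodule A E.Homology :=
  ((E.deg n).comap E.cycles.val.toLinearMap).map (Ideal.Quotient.mkₐ A E.boundaries).toLinearMap

variable (B : Type w) [CommRing B] [Algebra A B]

/-- The extension of scalars `B ⊗ E` of a differential graded algebra, with differential `1 ⊗ d`. -/
def baseChange : DGAlg.{w, max w v} B where
  carrier := B ⊗[A] E.carrier
  deg n := (E.deg n).baseChange B
  d := E.d.baseChange B
  d_mem n x hx := by
    have : (E.deg (n + 1)).baseChange B ≤ ((E.deg n).baseChange B).comap (E.d.baseChange B) := by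
      rw [Submodule.baseChange_eq_span, Submodule.span_le]
      rintro _ ⟨y, hy, rfl⟩
      simpa using Submodule.tmul_mem_baseChange_of_mem (1 : B) (E.d_mem n y hy)
    exact this hx
  d_deg_zero x hx := by
    have : (E.deg 0).baseChange B ≤ LinearMap.ker (E.d.baseChange B) := by
      rw [Submodule.baseChange_eq_span, Submodule.span_le]
      rintro _ ⟨y, hy, rfl⟩
      simp [E.d_deg_zero y hy]
    exact this hx
  d_d x := by
    induction x using TensorProduct.induction_on with
    | zero => simp
    | tmul b y => simp [E.d_d]
    | add a b ha hb => simp [ha, hb]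
  leibniz n x y hx := by
    rw [Submodule.baseChange_eq_span] at hx
    induction hx using Submodule.span_induction with
    | mem x hx =>
      obtain ⟨x, hx, rfl⟩ := hx
      induction y using TensorProduct.induction_on with
      | zero => simp
      | tmul b y =>
        have : ((-1 : B) ^ n) = algebraMap A B ((-1) ^ n) := by simp
        simp only [TensorProduct.mk_apply, Algebra.TensorProduct.tmul_mul_tmul,
          LinearMap.baseChange_tmul, E.leibniz n x y hx, TensorProduct.tmul_add, this,
          algebraMap_smul, TensorProduct.tmul_smul]
      | add a b ha hb => simp only [mul_add, map_add, ha, hb, smul_add]; abel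
    | zero => simp
    | add a b _ _ ha hb => simp only [add_mul, map_add, ha, hb, smul_add]; abel
    | smul c a _ ha => simp only [smul_mul_assoc, map_smul, ha, smul_add, smul_comm c]

end DGAlg

section Koszul

variable {R : Type u} [CommRing R]

section Contract

variable {V : Type v} [AddCommGroup V] [Module R V] {T : Type w} [CommRing T] [Algebra R T]

/-- One step in the recursion that defines `contractInto`. -/
def contractIntoAux (θ : V →ₗ[R] T) :
    V →ₗ[R] ExteriorAlgebra R V × (T ⊗[R] ExteriorAlgebra R V) →ₗ[R]
      T ⊗[R] ExteriorAlgebra R V :=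
  ((TensorProduct.mk R T (ExteriorAlgebra R V)) ∘ₗ θ).compl₂ (LinearMap.fst R _ _) -
    ((LinearMap.mul R (T ⊗[R] ExteriorAlgebra R V)) ∘ₗ
      (TensorProduct.mk R T (ExteriorAlgebra R V) 1) ∘ₗ ExteriorAlgebra.ι R).compl₂
        (LinearMap.snd R _ _)

lemma contractIntoAux_apply (θ : V →ₗ[R] T) (v : V) (x : ExteriorAlgebra R V)
    (y : T ⊗[R] ExteriorAlgebra R V) :
    contractIntoAux θ v (x, y) = θ v ⊗ₜ x - (1 ⊗ₜ ExteriorAlgebra.ι R v) * y := rfl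

/-- The antiderivation `Λ V → T ⊗ Λ V` with `v ↦ θ v ⊗ 1` for `v` in `V`, that is,
`v₁ ⋯ vₙ ↦ ∑ᵢ (-1)^(i-1) θ vᵢ ⊗ v₁ ⋯ vᵢ₋₁ vᵢ₊₁ ⋯ vₙ`. -/
def contractInto (θ : V →ₗ[R] T) : ExteriorAlgebra R V →ₗ[R] T ⊗[R] ExteriorAlgebra R V :=
  CliffordAlgebra.foldr' 0 (contractIntoAux θ)
    (fun m x fx => by
      have h : (CliffordAlgebra.ι (0 : QuadraticForm R V)) m = ExteriorAlgebra.ι R m := rfl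
      rw [contractIntoAux_apply, contractIntoAux_apply, h, mul_sub, ← mul_assoc,
        Algebra.TensorProduct.tmul_mul_tmul, Algebra.TensorProduct.tmul_mul_tmul,
        ExteriorAlgebra.ι_sq_zero]
      simp) 0

@[simp] lemma contractInto_algebraMap (θ : V →ₗ[R] T) (r : R) :
    contractInto θ (algebraMap R _ r) = 0 :=
  (CliffordAlgebra.foldr'_algebraMap _ _ _ _ _).trans (smul_zero _)

lemma contractInto_ι_mul (θ : V →ₗ[R] T) (v : V) (x : ExteriorAlgebra R V) :
    contractInto θ (ExteriorAlgebra.ι R v * x) =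
      θ v ⊗ₜ x - (1 ⊗ₜ ExteriorAlgebra.ι R v) * contractInto θ x :=
  CliffordAlgebra.foldr'_ι_mul _ _ _ _ _ _

@[elab_as_elim]
lemma ext_induction {P : ExteriorAlgebra R V → Prop} (hr : ∀ r, P (algebraMap R _ r))
    (ha : ∀ x y, P x → P y → P (x + y)) (hm : ∀ v x, P x → P (ExteriorAlgebra.ι R v * x))
    (x : ExteriorAlgebra R V) : P x := by
  induction x using CliffordAlgebra.left_induction with
  | algebraMap r => exact hr r
  | add x y hx hy => exact ha x y hx hy
  | ι_mul x v hx => exact hm v x hx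

lemma extPow_eq (n : ℕ) : ⋀[R]^n V = LinearMap.range (ExteriorAlgebra.ι R (M := V)) ^ n := rfl

lemma contractInto_mem (θ : V →ₗ[R] T) (n : ℕ) (x : ExteriorAlgebra R V)
    (hx : x ∈ ⋀[R]^(n + 1) V) : contractInto θ x ∈ (⋀[R]^n V).baseChange T := by
  induction n generalizing x with
  | zero =>
    rw [zero_add, extPow_eq, pow_one] at hx
    obtain ⟨v, rfl⟩ := hx
    rw [← mul_one (ExteriorAlgebra.ι R v), contractInto_ι_mul, ← map_one (algebraMap R _),
      contractInto_algebraMap, mul_zero, sub_zero]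
    exact Submodule.tmul_mem_baseChange_of_mem _ (SetLike.algebraMap_mem_graded _ _)
  | succ n ih =>
    rw [extPow_eq, pow_succ'] at hx
    induction hx using Submodule.mul_induction_on' with
    | mem_mul_mem v hv y hy =>
      obtain ⟨v, rfl⟩ := hv
      rw [contractInto_ι_mul]
      refine Submodule.sub_mem _ (Submodule.tmul_mem_baseChange_of_mem _ hy) ?_
      have h1 : (1 : T) ⊗ₜ[R] ExteriorAlgebra.ι R v ∈ (⋀[R]^1 V).baseChange T :=
        Submodule.tmul_mem_baseChange_of_mem _ (by rw [extPow_eq, pow_one]; exact ⟨v, rfl⟩)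
      have := SetLike.mul_mem_graded (A := fun i : ℕ => (⋀[R]^i V).baseChange T) h1 (ih y hy)
      rwa [add_comm 1 n] at this
    | add x _ y _ hx hy => rw [map_add]; exact Submodule.add_mem _ hx hy

lemma contractInto_add (θ θ' : V →ₗ[R] T) :
    contractInto (θ + θ') = contractInto θ + contractInto θ' := by
  refine LinearMap.ext fun x => ?_
  refine ext_induction (P := fun x => contractInto (θ + θ') x =
    (contractInto θ + contractInto θ') x) ?_ ?_ ?_ x
  · intro r; simp
  · intro x y hx hy; simp only [map_add, hx, hy]
  · intro v x hx
    simp only [LinearMap.add_apply, contractInto_ι_mul] at *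
    rw [hx, TensorProduct.add_tmul, mul_add]; abel

lemma contractInto_scalar (f : Module.Dual R V) (x : ExteriorAlgebra R V) :
    contractInto ((Algebra.linearMap R T) ∘ₗ f) x = 1 ⊗ₜ CliffordAlgebra.contractLeft f x := by
  induction x using ext_induction with
  | hr r =>
    rw [contractInto_algebraMap]
    exact (by rw [CliffordAlgebra.contractLeft_algebraMap, TensorProduct.tmul_zero])
  | ha x y hx hy => simp only [map_add, hx, hy, TensorProduct.tmul_add]
  | hm v x hx =>
    rw [contractInto_ι_mul, hx]
    refine Eq.trans ?_ (congrArg _ (CliffordAlgebra.contractLeft_ι_mul (Q := 0) (d := f) v x).symm)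
    rw [TensorProduct.tmul_sub, Algebra.TensorProduct.tmul_mul_tmul, one_mul,
      TensorProduct.tmul_smul, TensorProduct.smul_tmul', Algebra.smul_def, mul_one]
    rfl

/-- The `T`-linear extension of `contractInto θ`. -/
def contractExt (θ : V →ₗ[R] T) : T ⊗[R] ExteriorAlgebra R V →ₗ[T] T ⊗[R] ExteriorAlgebra R V :=
  (contractInto θ).liftBaseChange T

@[simp] lemma contractExt_tmul (θ : V →ₗ[R] T) (t : T) (x : ExteriorAlgebra R V) :
    contractExt θ (t ⊗ₜ x) = t • contractInto θ x := rfl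

lemma contractExt_ι_mul (θ : V →ₗ[R] T) (v : V) (x : T ⊗[R] ExteriorAlgebra R V) :
    contractExt θ ((1 ⊗ₜ ExteriorAlgebra.ι R v) * x) =
      θ v • x - (1 ⊗ₜ ExteriorAlgebra.ι R v) * contractExt θ x := by
  induction x using TensorProduct.induction_on with
  | zero => simp
  | tmul t x =>
    rw [Algebra.TensorProduct.tmul_mul_tmul, one_mul, contractExt_tmul, contractInto_ι_mul,
      contractExt_tmul, smul_sub, mul_smul_comm, TensorProduct.smul_tmul', TensorProduct.smul_tmul',
      smul_eq_mul, smul_eq_mul, mul_comm]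
  | add a b ha hb => simp only [mul_add, map_add, ha, hb, smul_add]; abel

lemma contractExt_contractExt (θ : V →ₗ[R] T) (x : T ⊗[R] ExteriorAlgebra R V) :
    contractExt θ (contractExt θ x) = 0 := by
  induction x using TensorProduct.induction_on with
  | zero => simp
  | tmul t x =>
    rw [contractExt_tmul, map_smul]
    suffices h : contractExt θ (contractInto θ x) = 0 by rw [h, smul_zero]
    induction x using ext_induction with
    | hr r => simp
    | ha x y hx hy => simp only [map_add, hx, hy, add_zero]
    | hm v x hx =>
      rw [contractInto_ι_mul, map_sub, contractExt_tmul, contractExt_ι_mul, hx]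
      simp
  | add a b ha hb => simp [ha, hb]

lemma contractExt_mul (θ : V →ₗ[R] T) (n : ℕ) (x y : T ⊗[R] ExteriorAlgebra R V)
    (hx : x ∈ (⋀[R]^n V).baseChange T) :
    contractExt θ (x * y) = contractExt θ x * y + (-1 : R) ^ n • (x * contractExt θ y) := by
  suffices h : ∀ x ∈ ⋀[R]^n V, contractExt θ ((1 ⊗ₜ x) * y) =
      contractInto θ x * y + (-1 : R) ^ n • ((1 ⊗ₜ x) * contractExt θ y) by
    rw [Submodule.baseChange_eq_span] at hx
    induction hx using Submodule.span_induction with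
    | mem x hx =>
      obtain ⟨x, hx, rfl⟩ := hx
      simpa using h x hx
    | zero => simp
    | add a b _ _ ha hb => simp only [add_mul, map_add, ha, hb, smul_add]; abel
    | smul c a _ ha => simp only [smul_mul_assoc, map_smul, ha, smul_add, smul_comm c]
  clear hx x
  induction n with
  | zero =>
    intro x hx
    rw [extPow_eq, pow_zero, Submodule.mem_one] at hx
    obtain ⟨r, rfl⟩ := hx
    have h1 : (1 : T) ⊗ₜ[R] (algebraMap R (ExteriorAlgebra R V) r) =
        algebraMap T _ (algebraMap R T r) := by
      rw [Algebra.algebraMap_eq_smul_one, TensorProduct.tmul_smul, TensorProduct.smul_tmul',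
        Algebra.TensorProduct.algebraMap_apply, Algebra.smul_def, mul_one]
      simp
    rw [h1, ← Algebra.smul_def, map_smul, contractInto_algebraMap, ← Algebra.smul_def]
    simp
  | succ n ih =>
    intro x hx
    rw [extPow_eq, pow_succ'] at hx
    induction hx using Submodule.mul_induction_on' with
    | mem_mul_mem v hv z hz =>
      obtain ⟨v, rfl⟩ := hv
      have h2 : (1 : T) ⊗ₜ[R] (ExteriorAlgebra.ι R v * z) =
          (1 ⊗ₜ ExteriorAlgebra.ι R v) * (1 ⊗ₜ z) := by simp
      have h3 : θ v ⊗ₜ[R] z = θ v • ((1 : T) ⊗ₜ[R] z) := by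
        rw [TensorProduct.smul_tmul', smul_eq_mul, mul_one]
      rw [contractInto_ι_mul, h2, mul_assoc, contractExt_ι_mul, ih z hz, h3, sub_mul, mul_add,
        smul_mul_assoc, pow_succ, mul_smul, mul_assoc, mul_smul_comm, mul_assoc]
      simp only [neg_smul, one_smul, smul_neg]
      abel
    | add x _ y _ hx hy =>
      simp only [TensorProduct.tmul_add, add_mul, map_add, hx, hy, smul_add]; abel

end Contract

section RestrictGrading

variable {T : Type w} [CommRing T] [Algebra R T] {S : Type v} [Ring S] [Algebra R S] [Algebra T S]
  [IsScalarTower R T S]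

/-- A grading by `T`-submodules is also a grading by `R`-submodules. -/
@[reducible] def restrictGrading (𝒜 : ℕ → Submodule T S) [GradedAlgebra 𝒜] :
    GradedAlgebra (fun n => (𝒜 n).restrictScalars R) where
  one_mem := SetLike.GradedOne.one_mem (A := 𝒜)
  mul_mem _ _ _ _ hx hy := SetLike.GradedMul.mul_mem (A := 𝒜) hx hy
  decompose' := DirectSum.Decomposition.decompose' (ℳ := 𝒜)
  left_inv := DirectSum.Decomposition.left_inv (ℳ := 𝒜)
  right_inv := DirectSum.Decomposition.right_inv (ℳ := 𝒜)

end RestrictGrading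

variable {ι : Type v}

/-- The sum `U⁽⁰⁾ ⊕ ⋯ ⊕ U⁽ˢ⁻¹⁾`, where `U⁽ᵏ⁾` is the free `R`-module on the formal monomials
`ũ_{i₁} ⋯ ũ_{iₖ}` of degree `k`, with monomials multiplied in the obvious way (a product of degree
at least `s` is zero): the polynomial algebra on the `ũᵢ` modulo all monomials of degree `s`. -/
abbrev TruncPoly (R : Type u) [CommRing R] (ι : Type v) (s : ℕ) : Type (max u v) :=
  MvPolynomial ι R ⧸ MvPolynomial.idealOfVars ι R ^ s

/-- The linear map `⨁ R eᵢ → R` with `eᵢ ↦ uᵢ`. -/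
def toU (u : ι → R) : (ι →₀ R) →ₗ[R] R := Finsupp.linearCombination R u

/-- The linear map `⨁ R eᵢ → TruncPoly R ι s` with `eᵢ ↦ ũᵢ`. -/
def toUTilde (R : Type u) [CommRing R] (ι : Type v) (s : ℕ) : (ι →₀ R) →ₗ[R] TruncPoly R ι s :=
  Finsupp.linearCombination R fun i => Ideal.Quotient.mk _ (MvPolynomial.X i)

/-- The Koszul algebra `K = Λ_R(eᵢ)`. -/
abbrev KoszulAlg (R : Type u) [CommRing R] (ι : Type v) : Type (max u v) :=
  ExteriorAlgebra R (ι →₀ R)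

/-- The Koszul differential: the antiderivation of `Λ_R(eᵢ)` with `d eᵢ = uᵢ`. -/
def koszulD (u : ι → R) : KoszulAlg R ι →ₗ[R] KoszulAlg R ι :=
  CliffordAlgebra.contractLeft (toU u)

/-- The differential `d_Q` of `⨁_{k<s} K ⊗ U⁽ᵏ⁾`: the Koszul differential on the factor `K`. -/
def dQ (u : ι → R) (s : ℕ) : TruncPoly R ι s ⊗[R] KoszulAlg R ι →ₗ[TruncPoly R ι s]
    TruncPoly R ι s ⊗[R] KoszulAlg R ι :=
  (koszulD u).baseChange (TruncPoly R ι s)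

/-- The map `∂` from `⨁_{k<s} K ⊗ U⁽ᵏ⁾` to itself that takes `K ⊗ U⁽ᵏ⁾` to `K ⊗ U⁽ᵏ⁺¹⁾` (to zero
when `k = s - 1`) and is given by the formula for `d_Q` with `ũᵢ` in place of `uᵢ`:
`e_{j₁} ⋯ e_{jₙ} ũ ↦ ∑ₐ (-1)^(a-1) e_{j₁} ⋯ e_{jₐ₋₁} e_{jₐ₊₁} ⋯ e_{jₙ} ũ_{jₐ} ũ`. -/
def del (R : Type u) [CommRing R] (ι : Type v) (s : ℕ) :
    TruncPoly R ι s ⊗[R] KoszulAlg R ι →ₗ[TruncPoly R ι s] TruncPoly R ι s ⊗[R] KoszulAlg R ι :=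
  contractExt (toUTilde R ι s)

lemma dQ_add_del (u : ι → R) (s : ℕ) :
    dQ u s + del R ι s =
      contractExt ((Algebra.linearMap R (TruncPoly R ι s)) ∘ₗ toU u + toUTilde R ι s) := by
  refine TensorProduct.AlgebraTensorModule.ext fun t x => ?_
  rw [contractExt_tmul, contractInto_add, LinearMap.add_apply, LinearMap.add_apply,
    contractInto_scalar, smul_add, TensorProduct.smul_tmul', smul_eq_mul, mul_one]
  rfl

/-- The differential graded algebra `K(R; Iˢ) = ⨁_{k<s} K ⊗ U⁽ᵏ⁾`, where `I` is the ideal generated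
by the sequence `u`. Its differential is `d_Q + ∂`, and an element of `U⁽ᵏ⁾` has degree zero. -/
def koszulPow (u : ι → R) (s : ℕ) : DGAlg.{u, max u v} R where
  carrier := TruncPoly R ι s ⊗[R] KoszulAlg R ι
  deg n := ((⋀[R]^n (ι →₀ R)).baseChange (TruncPoly R ι s)).restrictScalars R
  graded := restrictGrading (R := R) fun n : ℕ => (⋀[R]^n (ι →₀ R)).baseChange (TruncPoly R ι s)
  d := (dQ u s + del R ι s).restrictScalars R
  d_mem n x hx := by
    rw [dQ_add_del]
    set θ := (Algebra.linearMap R (TruncPoly R ι s)) ∘ₗ toU u + toUTilde R ι s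
    have : (⋀[R]^(n + 1) (ι →₀ R)).baseChange (TruncPoly R ι s) ≤
        ((⋀[R]^n (ι →₀ R)).baseChange (TruncPoly R ι s)).comap (contractExt θ) := by
      rw [Submodule.baseChange_eq_span, Submodule.span_le]
      rintro _ ⟨y, hy, rfl⟩
      simpa using contractInto_mem θ n y hy
    exact this hx
  d_deg_zero x hx := by
    rw [dQ_add_del]
    set θ := (Algebra.linearMap R (TruncPoly R ι s)) ∘ₗ toU u + toUTilde R ι s
    have : (⋀[R]^0 (ι →₀ R)).baseChange (TruncPoly R ι s) ≤ LinearMap.ker (contractExt θ) := by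
      rw [Submodule.baseChange_eq_span, Submodule.span_le]
      rintro _ ⟨y, hy, rfl⟩
      rw [SetLike.mem_coe, extPow_eq, pow_zero, Submodule.mem_one] at hy
      obtain ⟨r, rfl⟩ := hy
      simp
    exact this hx
  d_d x := by rw [dQ_add_del]; exact contractExt_contractExt _ x
  leibniz n x y hx := by rw [dQ_add_del]; exact contractExt_mul _ n x y hx

end Koszul

section TorAlgebra

open CategoryTheory

section Lift

variable {R : Type u} [CommRing R] {B : Type u} [CommRing B] [Algebra R B]
  (P : ProjectiveResolution (ModuleCat.of R B))

/-- The augmentation `P₀ → B` of a projective resolution of `B`. -/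
def aug : P.complex.X 0 →ₗ[R] B :=
  (P.π.f 0 ≫ (HomologicalComplex.singleObjXSelf (ComplexShape.down ℕ) 0 (ModuleCat.of R B)).hom).hom

lemma aug_surjective : Function.Surjective (aug P) := by
  have : Epi (P.π.f 0 ≫ (HomologicalComplex.singleObjXSelf (ComplexShape.down ℕ) 0 (ModuleCat.of R B)).hom) := epi_comp _ _
  exact (ModuleCat.epi_iff_surjective _).1 this

lemma aug_d (x : P.complex.X 1) : aug P ((P.complex.d 1 0).hom x) = 0 := by
  have h := P.complex_d_comp_π_f_zero
  have : (P.complex.d 1 0 ≫ (P.π.f 0 ≫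
      (HomologicalComplex.singleObjXSelf (ComplexShape.down ℕ) 0 (ModuleCat.of R B)).hom)).hom x = 0 := by
    rw [← Category.assoc, h, Limits.zero_comp]; rfl
  exact this

lemma exists_of_aug_eq_zero (x : P.complex.X 0) (hx : aug P x = 0) :
    ∃ y, (P.complex.d 1 0).hom y = x := by
  have h := (ShortComplex.moduleCat_exact_iff _).1 P.exact₀ x
  apply h
  have h2 : Mono (HomologicalComplex.singleObjXSelf (ComplexShape.down ℕ) 0 (ModuleCat.of R B)).hom := inferInstance
  apply (ModuleCat.mono_iff_injective _).1 h2
  rw [map_zero]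
  exact hx

lemma exists_of_d_eq_zero (n : ℕ) (x : P.complex.X (n + 1))
    (hx : (P.complex.d (n + 1) n).hom x = 0) : ∃ y, (P.complex.d (n + 2) (n + 1)).hom y = x :=
  (ShortComplex.moduleCat_exact_iff _).1 (P.exact_succ n) x hx

lemma d_d_apply (i j k : ℕ) (x : P.complex.X i) :
    (P.complex.d j k).hom ((P.complex.d i j).hom x) = 0 := by
  have h := P.complex.d_comp_d i j k
  have := congrArg (fun f => f.hom x) h
  exact this

lemma d_self_apply (i : ℕ) (x : P.complex.X i) : (P.complex.d i i).hom x = 0 := by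
  rw [P.complex.shape i i (by simp)]; rfl

/-- A lift of the multiplication `B ⊗ B → B` to a chain map `P ⊗ P → P`, where `P` is a projective
resolution of the `R`-algebra `B`. The chain map is given by its components
`Pₘ × Pₙ → Pₖ` for `k = m + n`; the components with `k ≠ m + n` are zero. Note that `m - 1 = 0` for
`m = 0`, and that `P.complex.d 0 0 = 0`. -/
structure MulLift where
  /-- the components -/
  μ : ∀ m n k : ℕ, P.complex.X m →ₗ[R] P.complex.X n →ₗ[R] P.complex.X k
  shape : ∀ m n k, m + n ≠ k → μ m n k = 0
  aug_μ : ∀ x y, aug P (μ 0 0 0 x y) = aug P x * aug P y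
  leibniz : ∀ m n k, m + n = k + 1 → ∀ x y,
    (P.complex.d (k + 1) k).hom (μ m n (k + 1) x y) =
      μ (m - 1) n k ((P.complex.d m (m - 1)).hom x) y +
        (-1 : R) ^ m • μ m (n - 1) k x ((P.complex.d n (n - 1)).hom y)

/-- All components of a lift of the multiplication with target `Pₖ`. -/
abbrev Lev (k : ℕ) : Type u := ∀ m n : ℕ, P.complex.X m →ₗ[R] P.complex.X n →ₗ[R] P.complex.X k

/-- The right-hand side of the Leibniz rule, for the components with target `Pₖ`. -/
def leibnizRHS {k : ℕ} (f : Lev P k) (m n : ℕ) :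
    P.complex.X m →ₗ[R] P.complex.X n →ₗ[R] P.complex.X k :=
  (f (m - 1) n) ∘ₗ (P.complex.d m (m - 1)).hom +
    (-1 : R) ^ m • (f m (n - 1)).compl₂ (P.complex.d n (n - 1)).hom

lemma leibnizRHS_apply {k : ℕ} (f : Lev P k) (m n : ℕ) (x : P.complex.X m) (y : P.complex.X n) :
    leibnizRHS P f m n x y = f (m - 1) n ((P.complex.d m (m - 1)).hom x) y +
      (-1 : R) ^ m • f m (n - 1) x ((P.complex.d n (n - 1)).hom y) := rfl

/-- The part of the definition of a lift that concerns the components with target `Pₖ₊₁`. -/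
def Compat {k : ℕ} (f : Lev P k) (g : Lev P (k + 1)) : Prop :=
  (∀ m n, m + n ≠ k + 1 → g m n = 0) ∧
    ∀ m n, m + n = k + 1 → ∀ x y, (P.complex.d (k + 1) k).hom (g m n x y) = leibnizRHS P f m n x y

lemma exists_bilin_lift (m n : ℕ) {M N : Type u} [AddCommGroup M] [Module R M] [AddCommGroup N]
    [Module R N] (δ : M →ₗ[R] N) (r : P.complex.X m →ₗ[R] P.complex.X n →ₗ[R] N)
    (h : ∀ x y, ∃ z, δ z = r x y) :
    ∃ g : P.complex.X m →ₗ[R] P.complex.X n →ₗ[R] M, ∀ x y, δ (g x y) = r x y := by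
  have hp : ∀ i, Module.Projective R (P.complex.X i) := fun i =>
    (IsProjective.iff_projective _).2 (P.projective i)
  have := hp m
  have := hp n
  have hr : ∀ t, TensorProduct.lift r t ∈ LinearMap.range δ := by
    intro t
    induction t using TensorProduct.induction_on with
    | zero => simp
    | tmul x y => exact h x y
    | add a b ha hb => rw [map_add]; exact Submodule.add_mem _ ha hb
  obtain ⟨q, hq⟩ := Module.projective_lifting_property δ.rangeRestrict
    ((TensorProduct.lift r).codRestrict (LinearMap.range δ) hr) δ.surjective_rangeRestrict
  refine ⟨TensorProduct.curry q, fun x y => ?_⟩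
  have := congrArg Subtype.val (LinearMap.congr_fun hq (x ⊗ₜ y))
  exact this

lemma exists_level (k : ℕ) (f : Lev P k)
    (h : ∀ m n, m + n = k + 1 → ∀ x y, ∃ z, (P.complex.d (k + 1) k).hom z = leibnizRHS P f m n x y) :
    ∃ g : Lev P (k + 1), Compat P f g := by
  classical
  have h' : ∀ m n, ∃ g : P.complex.X m →ₗ[R] P.complex.X n →ₗ[R] P.complex.X (k + 1),
      (m + n ≠ k + 1 → g = 0) ∧ (m + n = k + 1 → ∀ x y,
        (P.complex.d (k + 1) k).hom (g x y) = leibnizRHS P f m n x y) := by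
    intro m n
    by_cases hmn : m + n = k + 1
    · obtain ⟨g, hg⟩ := exists_bilin_lift P m n (P.complex.d (k + 1) k).hom (leibnizRHS P f m n)
        (h m n hmn)
      exact ⟨g, fun h => absurd hmn h, fun _ => hg⟩
    · exact ⟨0, fun _ => rfl, fun h => absurd h hmn⟩
  choose g hg using h'
  exact ⟨g, fun m n => (hg m n).1, fun m n => (hg m n).2⟩

lemma exists_level_succ (k : ℕ) (f : Lev P k) (g : Lev P (k + 1)) (hfg : Compat P f g) :
    ∃ h : Lev P (k + 2), Compat P g h := by
  refine exists_level P (k + 1) g fun m n hmn x y => exists_of_d_eq_zero P k _ ?_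
  have h1 : (P.complex.d (k + 1) k).hom (g (m - 1) n ((P.complex.d m (m - 1)).hom x) y) =
      - ((-1 : R) ^ m • f (m - 1) (n - 1) ((P.complex.d m (m - 1)).hom x)
        ((P.complex.d n (n - 1)).hom y)) := by
    cases m with
    | zero => simp only [d_self_apply, map_zero, LinearMap.zero_apply, smul_zero,
        neg_zero]
    | succ m =>
      rw [hfg.2 _ _ (by simp; omega), leibnizRHS_apply, d_d_apply, pow_succ]
      simp
  have h2 : (P.complex.d (k + 1) k).hom (g m (n - 1) x ((P.complex.d n (n - 1)).hom y)) =
      f (m - 1) (n - 1) ((P.complex.d m (m - 1)).hom x) ((P.complex.d n (n - 1)).hom y) := by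
    cases n with
    | zero => simp only [d_self_apply, map_zero]
    | succ n =>
      rw [hfg.2 _ _ (by simp; omega), leibnizRHS_apply, d_d_apply]
      simp
  rw [leibnizRHS_apply, map_add, map_smul, h1, h2, neg_add_cancel]

lemma exists_level_zero : ∃ f : Lev P 0, (∀ m n, m + n ≠ 0 → f m n = 0) ∧
    ∀ x y, aug P (f 0 0 x y) = aug P x * aug P y := by
  obtain ⟨g, hg⟩ := exists_bilin_lift P 0 0 (aug P)
    ((LinearMap.mul R B).compl₁₂ (aug P) (aug P)) (fun x y => aug_surjective P _)
  refine ⟨fun m n => match m, n with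
    | 0, 0 => g
    | _, _ => 0, fun m n h => ?_, fun x y => hg x y⟩
  rcases m with _ | m
  · rcases n with _ | n
    · exact absurd rfl h
    · rfl
  · rfl

lemma exists_level_one (f : Lev P 0) (hf : ∀ x y, aug P (f 0 0 x y) = aug P x * aug P y) :
    ∃ g : Lev P 1, Compat P f g := by
  refine exists_level P 0 f fun m n hmn x y => exists_of_aug_eq_zero P _ ?_
  obtain ⟨rfl, rfl⟩ | ⟨rfl, rfl⟩ : (m = 0 ∧ n = 1) ∨ (m = 1 ∧ n = 0) := by omega
  · have := aug_d P y
    simp only [leibnizRHS_apply, d_self_apply, map_zero,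
      LinearMap.zero_apply, zero_add, pow_zero, one_smul, hf, this, mul_zero]
  · have := aug_d P x
    simp only [leibnizRHS_apply, d_self_apply, map_zero,
      smul_zero, add_zero, hf, this, zero_mul]

/-- Lifts of the multiplication exist on every projective resolution. -/
theorem exists_mulLift : Nonempty (MulLift P) := by
  obtain ⟨f, hf0, hf⟩ := exists_level_zero P
  obtain ⟨g, hg⟩ := exists_level_one P f hf
  choose next hnext using exists_level_succ P
  let S : ∀ k, {p : Lev P k × Lev P (k + 1) // Compat P p.1 p.2} := fun k =>
    Nat.rec ⟨(f, g), hg⟩ (fun k p => ⟨(p.1.2, next k p.1.1 p.1.2 p.2), hnext k _ _ p.2⟩) k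
  have hS : ∀ k, Compat P (S k).1.1 (S (k + 1)).1.1 := fun k => (S k).2
  refine ⟨⟨fun m n k => (S k).1.1 m n, fun m n k h => ?_, hf,
    fun m n k h x y => (hS k).2 m n h x y⟩⟩
  cases k with
  | zero => exact hf0 m n h
  | succ k => exact (hS k).1 m n h

end Lift

section HomologyAt

variable {A : Type v} [CommRing A] {M₁ M₂ M₃ : Type*} [AddCommGroup M₁] [AddCommGroup M₂]
  [AddCommGroup M₃] [Module A M₁] [Module A M₂] [Module A M₃]

/-- The homology `ker g / im f` of `M₁ --f--> M₂ --g--> M₃`. -/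
abbrev HomologyAt (f : M₁ →ₗ[A] M₂) (g : M₂ →ₗ[A] M₃) :=
  LinearMap.ker g ⧸ (LinearMap.range f).submoduleOf (LinearMap.ker g)

/-- The class of a cycle. -/
def HomologyAt.mk (f : M₁ →ₗ[A] M₂) (g : M₂ →ₗ[A] M₃) : LinearMap.ker g →ₗ[A] HomologyAt f g :=
  Submodule.mkQ _

end HomologyAt

section Tor

variable {R : Type u} [CommRing R] (A : Type u) [CommRing A] [Algebra R A]
  {B : Type u} [CommRing B] [Algebra R B] (P : ProjectiveResolution (ModuleCat.of R B))

/-- The differential `1 ⊗ d` of the complex `A ⊗ P`. -/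
def tensorD (i j : ℕ) : A ⊗[R] P.complex.X i →ₗ[A] A ⊗[R] P.complex.X j :=
  (P.complex.d i j).hom.baseChange A

/-- The homology `Hₙ(A ⊗ P)` (note that `P.complex.d 0 0 = 0`). -/
abbrev tensorHomology (n : ℕ) : Type u :=
  HomologyAt (tensorD A P (n + 1) n) (tensorD A P n (n - 1))

/-- The extension of scalars of a bilinear map, `(a ⊗ x, b ⊗ y) ↦ a b ⊗ f x y`. -/
def bilinBaseChange {M N L : Type*} [AddCommGroup M] [AddCommGroup N] [AddCommGroup L]
    [Module R M] [Module R N] [Module R L] (f : M →ₗ[R] N →ₗ[R] L) :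
    A ⊗[R] M →ₗ[A] A ⊗[R] N →ₗ[A] A ⊗[R] L :=
  ((LinearMap.baseChangeHom R A N L) ∘ₗ f).liftBaseChange A

@[simp] lemma bilinBaseChange_tmul {M N L : Type*} [AddCommGroup M] [AddCommGroup N]
    [AddCommGroup L] [Module R M] [Module R N] [Module R L] (f : M →ₗ[R] N →ₗ[R] L)
    (a b : A) (x : M) (y : N) :
    bilinBaseChange A f (a ⊗ₜ x) (b ⊗ₜ y) = (a * b) ⊗ₜ f x y := rfl

variable {P}

/-- The product `(A ⊗ Pₘ) × (A ⊗ Pₙ) → A ⊗ Pₖ`, `(a ⊗ x, b ⊗ y) ↦ a b ⊗ μ(x, y)`. -/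
def MulLift.tensorMul (F : MulLift P) (m n k : ℕ) :
    A ⊗[R] P.complex.X m →ₗ[A] A ⊗[R] P.complex.X n →ₗ[A] A ⊗[R] P.complex.X k :=
  bilinBaseChange A (F.μ m n k)

lemma MulLift.tensorD_tensorMul (F : MulLift P) (m n k : ℕ) (h : m + n = k + 1)
    (x : A ⊗[R] P.complex.X m) (y : A ⊗[R] P.complex.X n) :
    tensorD A P (k + 1) k (F.tensorMul A m n (k + 1) x y) =
      F.tensorMul A (m - 1) n k (tensorD A P m (m - 1) x) y +
        (-1 : R) ^ m • F.tensorMul A m (n - 1) k x (tensorD A P n (n - 1) y) := by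
  induction x using TensorProduct.induction_on with
  | zero => simp
  | tmul a x =>
    induction y using TensorProduct.induction_on with
    | zero => simp
    | tmul b y =>
      simp only [tensorD, tensorMul, bilinBaseChange_tmul, LinearMap.baseChange_tmul,
        F.leibniz m n k h, TensorProduct.tmul_add, TensorProduct.tmul_smul]
    | add c d hc hd => simp only [map_add, hc, hd, smul_add]; abel
  | add c d hc hd => simp only [map_add, LinearMap.add_apply, hc, hd, smul_add]; abel

lemma tensorD_self (i : ℕ) : tensorD A P i i = 0 := by
  rw [tensorD, P.complex.shape i i (by simp), ModuleCat.hom_zero, LinearMap.baseChange_zero]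

/-- The product of cycles is a cycle. -/
lemma MulLift.tensorMul_mem_ker (F : MulLift P) (m n : ℕ) (x : A ⊗[R] P.complex.X m)
    (y : A ⊗[R] P.complex.X n) (hx : x ∈ LinearMap.ker (tensorD A P m (m - 1)))
    (hy : y ∈ LinearMap.ker (tensorD A P n (n - 1))) :
    F.tensorMul A m n (m + n) x y ∈ LinearMap.ker (tensorD A P (m + n) (m + n - 1)) := by
  rw [LinearMap.mem_ker] at *
  generalize hk : m + n = k
  cases k with
  | zero => exact LinearMap.congr_fun (tensorD_self A 0) _
  | succ k =>
    rw [Nat.add_sub_cancel, F.tensorD_tensorMul A m n k hk, hx, hy]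
    simp

/-- The product of cycles. -/
def MulLift.cycleMul (F : MulLift P) (m n : ℕ) :
    LinearMap.ker (tensorD A P m (m - 1)) →ₗ[A] LinearMap.ker (tensorD A P n (n - 1)) →ₗ[A]
      LinearMap.ker (tensorD A P (m + n) (m + n - 1)) :=
  LinearMap.mk₂ A (fun x y => ⟨F.tensorMul A m n (m + n) x y,
      F.tensorMul_mem_ker A m n _ _ x.2 y.2⟩)
    (fun _ _ _ => Subtype.ext (by simp)) (fun _ _ _ => Subtype.ext (by simp))
    (fun _ _ _ => Subtype.ext (by simp)) (fun _ _ _ => Subtype.ext (by simp))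

lemma MulLift.cycleMul_left (F : MulLift P) (m n : ℕ) (x : LinearMap.ker (tensorD A P m (m - 1)))
    (y : LinearMap.ker (tensorD A P n (n - 1)))
    (hx : (x : A ⊗[R] P.complex.X m) ∈ LinearMap.range (tensorD A P (m + 1) m)) :
    (F.cycleMul A m n x y : A ⊗[R] P.complex.X (m + n)) ∈
      LinearMap.range (tensorD A P (m + n + 1) (m + n)) := by
  obtain ⟨w, hw⟩ := hx
  refine ⟨F.tensorMul A (m + 1) n (m + n + 1) w y, ?_⟩
  rw [F.tensorD_tensorMul A (m + 1) n (m + n) (by omega), LinearMap.mem_ker.1 y.2, map_zero,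
    smul_zero, add_zero]
  change F.tensorMul A m n (m + n) (tensorD A P (m + 1) m w) y = _
  rw [hw]
  rfl

lemma MulLift.cycleMul_right (F : MulLift P) (m n : ℕ) (x : LinearMap.ker (tensorD A P m (m - 1)))
    (y : LinearMap.ker (tensorD A P n (n - 1)))
    (hy : (y : A ⊗[R] P.complex.X n) ∈ LinearMap.range (tensorD A P (n + 1) n)) :
    (F.cycleMul A m n x y : A ⊗[R] P.complex.X (m + n)) ∈
      LinearMap.range (tensorD A P (m + n + 1) (m + n)) := by
  obtain ⟨w, hw⟩ := hy
  refine ⟨(-1 : R) ^ m • F.tensorMul A m (n + 1) (m + n + 1) x w, ?_⟩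
  rw [LinearMap.map_smul_of_tower, F.tensorD_tensorMul A m (n + 1) (m + n) (by omega),
    LinearMap.mem_ker.1 x.2, map_zero, LinearMap.zero_apply, zero_add, smul_smul, ← mul_pow]
  change _ • F.tensorMul A m n (m + n) x (tensorD A P (n + 1) n w) = _
  rw [hw]
  simp
  rfl

/-- The bilinear map induced on quotients. -/
def bilinQuot {A M N L : Type*} [CommRing A] [AddCommGroup M] [AddCommGroup N] [AddCommGroup L]
    [Module A M] [Module A N] [Module A L] (f : M →ₗ[A] N →ₗ[A] L) (M' : Submodule A M)
    (N' : Submodule A N) (L' : Submodule A L) (hM : ∀ x ∈ M', ∀ y, f x y ∈ L')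
    (hN : ∀ x, ∀ y ∈ N', f x y ∈ L') : (M ⧸ M') →ₗ[A] (N ⧸ N') →ₗ[A] (L ⧸ L') :=
  Submodule.liftQ M' (LinearMap.flip (Submodule.liftQ N' (LinearMap.flip (f.compr₂ L'.mkQ))
      (fun y hy => LinearMap.mem_ker.2 <| LinearMap.ext fun x =>
        (Submodule.Quotient.mk_eq_zero L').2 (hN x y hy))))
    (fun x hx => LinearMap.mem_ker.2 <| LinearMap.ext fun y => by
      obtain ⟨y, rfl⟩ := Submodule.Quotient.mk_surjective _ y
      exact (Submodule.Quotient.mk_eq_zero L').2 (hM x hx y))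

/-- The product on homology, `[x] [y] = [x y]`. -/
def MulLift.homologyMul (F : MulLift P) (m n : ℕ) :
    tensorHomology A P m →ₗ[A] tensorHomology A P n →ₗ[A] tensorHomology A P (m + n) :=
  bilinQuot (F.cycleMul A m n) _ _ _
    (fun x hx y => Submodule.mem_comap.2 (F.cycleMul_left A m n x y (Submodule.mem_comap.1 hx)))
    (fun x y hy => Submodule.mem_comap.2 (F.cycleMul_right A m n x y (Submodule.mem_comap.1 hy)))

lemma MulLift.homologyMul_mk (F : MulLift P) (m n : ℕ)
    (x : LinearMap.ker (tensorD A P m (m - 1))) (y : LinearMap.ker (tensorD A P n (n - 1))) :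
    F.homologyMul A m n (HomologyAt.mk _ _ x) (HomologyAt.mk _ _ y) =
      HomologyAt.mk _ _ (F.cycleMul A m n x y) := rfl

/-- The class of `1 ⊗ e` for any `e` in `P₀` with augmentation `1`. -/
def homologyOne (P : ProjectiveResolution (ModuleCat.of R B)) : tensorHomology A P 0 :=
  HomologyAt.mk _ _ ⟨1 ⊗ₜ (aug_surjective P 1).choose,
    LinearMap.mem_ker.2 (LinearMap.congr_fun (tensorD_self A 0) _)⟩

/-- `Torₙ^R(A, B)` for commutative `R`-algebras `A` and `B`, as an `A`-module: the homology of
`A ⊗ P` for a projective resolution `P` of `B`. -/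
def Tor (R : Type u) [CommRing R] (A : Type u) [CommRing A] [Algebra R A] (B : Type u) [CommRing B]
    [Algebra R B] (n : ℕ) : Type u :=
  tensorHomology A (projectiveResolution (ModuleCat.of R B)) n

variable (R B)

instance (n : ℕ) : AddCommGroup (Tor R A B n) :=
  inferInstanceAs (AddCommGroup (tensorHomology A (projectiveResolution (ModuleCat.of R B)) n))

instance (n : ℕ) : Module A (Tor R A B n) :=
  inferInstanceAs (Module A (tensorHomology A (projectiveResolution (ModuleCat.of R B)) n))

/-- The product `Torₘ^R(A, B) × Torₙ^R(A, B) → Torₘ₊ₙ^R(A, B)`: the product induced on the homology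
of `A ⊗ P` by the multiplication of `A` and by a chain map `P ⊗ P → P` that lifts the multiplication
of `B` (all such chain maps are homotopic). -/
def torMul (m n : ℕ) : Tor R A B m →ₗ[A] Tor R A B n →ₗ[A] Tor R A B (m + n) :=
  (exists_mulLift (projectiveResolution (ModuleCat.of R B))).some.homologyMul A m n

instance : DirectSum.GNonUnitalNonAssocSemiring (Tor R A B) where
  mul x y := torMul R A B _ _ x y
  mul_zero x := map_zero (torMul R A B _ _ x)
  zero_mul y := LinearMap.map_zero₂ (torMul R A B _ _) y
  mul_add x := map_add (torMul R A B _ _ x)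
  add_mul x x' y := LinearMap.map_add₂ (torMul R A B _ _) x x' y

instance : GradedMonoid.GOne (Tor R A B) where
  one := homologyOne A (projectiveResolution (ModuleCat.of R B))

/-- The graded object `Tor_*^R(A, B)` with its `A`-module structure, product and unit. -/
abbrev TorAlg : Type u := ⨁ n, Tor R A B n


/-- `A`-linear maps `f`, `g` that agree as `R`-linear maps with the maps of a short complex of
`R`-modules have the homology of that short complex. -/
def homologyAtEquiv {M₁ M₂ M₃ : Type u} [AddCommGroup M₁] [AddCommGroup M₂] [AddCommGroup M₃]
    [Module A M₁] [Module A M₂] [Module A M₃] [Module R M₁] [Module R M₂] [Module R M₃]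
    [IsScalarTower R A M₁] [IsScalarTower R A M₂] [IsScalarTower R A M₃]
    (f : M₁ →ₗ[A] M₂) (g : M₂ →ₗ[A] M₃) (S : ShortComplex (ModuleCat.{u} R)) (e : S.X₂ ≃ₗ[R] M₂)
    (hg : ∀ x, S.g.hom x = 0 ↔ g (e x) = 0)
    (hf : ∀ x : S.X₂, (∃ y, S.f.hom y = x) ↔ ∃ y, f y = e x) :
    (LinearMap.ker S.g.hom ⧸ LinearMap.range S.moduleCatToCycles) ≃ₗ[R] HomologyAt f g := by
  let q : LinearMap.ker S.g.hom →ₗ[R] HomologyAt f g :=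
    { toFun := fun x => HomologyAt.mk f g ⟨e x.1, (hg _).1 x.2⟩
      map_add' := fun x y => by
        rw [← map_add]; congr 1; ext; simp
      map_smul' := fun r x => by
        rw [RingHom.id_apply, ← LinearMap.map_smul_of_tower]; congr 1; ext; simp }
  have hq : LinearMap.ker q = LinearMap.range S.moduleCatToCycles := by
    ext x
    rw [LinearMap.mem_ker, LinearMap.mem_range]
    refine (Submodule.Quotient.mk_eq_zero _).trans ((hf x.1).symm.trans ?_)
    exact exists_congr fun y => ⟨fun h => Subtype.ext h, fun h => congrArg Subtype.val h⟩
  have hs : Function.Surjective q := by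
    intro z
    obtain ⟨⟨z, hz⟩, rfl⟩ := Submodule.Quotient.mk_surjective _ z
    refine ⟨⟨e.symm z, (hg _).2 (by simpa using hz)⟩, ?_⟩
    change HomologyAt.mk f g ⟨_, _⟩ = HomologyAt.mk f g ⟨z, hz⟩
    congr 2
    simp
  exact (Submodule.quotEquivOfEq _ _ hq.symm).trans (q.quotKerEquivOfSurjective hs)

instance (n : ℕ) : Module R (Tor R A B n) :=
  inferInstanceAs (Module R (tensorHomology A (projectiveResolution (ModuleCat.of R B)) n))

open MonoidalCategory in
/-- The modules `Tor R A B n` are the values of the functor `CategoryTheory.Tor`. -/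
def torIso (n : ℕ) :
    ((CategoryTheory.Tor (ModuleCat.{u} R) n).obj (ModuleCat.of R A)).obj (ModuleCat.of R B) ≅
      ModuleCat.of R (Tor R A B n) :=
  (projectiveResolution (ModuleCat.of R B)).isoLeftDerivedObj
      ((tensoringLeft (ModuleCat.{u} R)).obj (ModuleCat.of R A)) n ≪≫
    ShortComplex.homologyMapIso (HomologicalComplex.isoSc' _ (n + 1) n (n - 1) (by simp)
      (by cases n <;> simp)) ≪≫
    ShortComplex.moduleCatHomologyIso _ ≪≫ LinearEquiv.toModuleIso
      (homologyAtEquiv R A _ _ _ (LinearEquiv.refl R _) (fun _ => Iff.rfl) (fun _ => Iff.rfl))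

end Tor

end TorAlgebra

/-- A finite (`N < ⊤`) or infinite (`N = ⊤`) sequence `u₀, u₁, …` of length `N` in `R` is regular if
each `uᵢ` is a nonzerodivisor on `R / (uⱼ : j < i)`. That `R / (u)` is nonzero is not required. -/
def IsRegularSeq {R : Type u} [CommRing R] {N : ℕ∞} (u : {i : ℕ // (i : ℕ∞) < N} → R) : Prop :=
  ∀ i, IsSMulRegular (R ⧸ Ideal.span (u '' Set.Iio i)) (u i)

end

end RegularQuotient

/-!
The differential graded algebra `K(R; Iˢ)` is a projective resolution of `R / Iˢ` whose product is a
lift of the multiplication of `R / Iˢ`; the theorem then follows because the homology of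
`R / I ⊗ P`, with its product, does not depend on the resolution `P` and on the lift.

With `T` the ring of truncated polynomials in the `ũᵢ`, the underlying complex of `K(R; Iˢ)` is
`T ⊗ Λ(eᵢ)` with the antiderivation `eᵢ ↦ uᵢ + ũᵢ`. Its terms are projective because `T` and the
exterior powers are. In degree zero the cokernel is `T / (uᵢ + ũᵢ) = R / Iˢ`, through `ũᵢ ↦ - uᵢ`
(`koszulPow_exact_zero`). In positive degrees the weight `k` of `Q⁽ᵏ⁾ = K ⊗ U⁽ᵏ⁾` filters the
complex: the differential is the Koszul differential plus the map `∂`, which raises the weight, so a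
cycle can be reduced to zero from its component of lowest weight on
(`exists_dQ_add_del_eq`), as soon as the Koszul complex of the regular sequence is exact
(`InitialPart.exists_koszulD_eq`, by induction on the number of generators involved, which also
covers infinite sequences) and stays exact after tensoring with `T`.

For two resolutions `P` and `Q` of the same algebra with lifts of its multiplication, the deviation
of a comparison map `P → Q` from being multiplicative is a chain map `P ⊗ P → Q` over zero, hence
null-homotopic (`exists_mulHomotopy`). So the isomorphism on homology respects the products
(`tensorHomologyMap_homologyMul`). For a differential graded algebra `E` that resolves `B`, the
homology of `A ⊗ E` in all degrees assembles to the homology algebra of `A ⊗ E`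
(`DGAlg.torEquiv`).
-/

namespace RegularQuotient

noncomputable section

open scoped TensorProduct DirectSum

/-! ### Exactness of the Koszul complex of a regular sequence -/

section KoszulExact

variable {R : Type u} [CommRing R] {N : ℕ∞}

/-- The elements of the Koszul algebra that lie in the subalgebra generated by the `eⱼ` with
`j < m`. -/
inductive InitialPart (R : Type u) [CommRing R] (N : ℕ∞) (m : ℕ) :
    KoszulAlg R {i : ℕ // (i : ℕ∞) < N} → Prop
  | scalar (r : R) : InitialPart R N m (algebraMap R _ r)
  | add {x y} : InitialPart R N m x → InitialPart R N m y → InitialPart R N m (x + y)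
  | ι_mul (j : {i : ℕ // (i : ℕ∞) < N}) (hj : j.1 < m) {x} : InitialPart R N m x →
      InitialPart R N m (ExteriorAlgebra.ι R (Finsupp.single j 1) * x)

namespace InitialPart

variable {m : ℕ} {x y : KoszulAlg R {i : ℕ // (i : ℕ∞) < N}}

lemma zero : InitialPart R N m 0 := by
  rw [← map_zero (algebraMap R _)]; exact scalar 0

lemma smul (r : R) (hx : InitialPart R N m x) : InitialPart R N m (r • x) := by
  induction hx with
  | scalar t => rw [Algebra.smul_def, ← map_mul]; exact scalar _
  | add _ _ hx hy => rw [smul_add]; exact add hx hy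
  | ι_mul j hj _ hx => rw [← mul_smul_comm]; exact ι_mul j hj hx

lemma neg (hx : InitialPart R N m x) : InitialPart R N m (-x) := by
  rw [← neg_one_smul R]; exact hx.smul _

lemma sub (hx : InitialPart R N m x) (hy : InitialPart R N m y) : InitialPart R N m (x - y) := by
  rw [sub_eq_add_neg]; exact hx.add hy.neg

lemma mono {m' : ℕ} (h : m ≤ m') (hx : InitialPart R N m x) : InitialPart R N m' x := by
  induction hx with
  | scalar t => exact scalar _
  | add _ _ hx hy => exact add hx hy
  | ι_mul j hj _ hx => exact ι_mul j (hj.trans_le h) hx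

lemma exists_mem (x : KoszulAlg R {i : ℕ // (i : ℕ∞) < N}) : ∃ m, InitialPart R N m x := by
  induction x using ext_induction with
  | hr r => exact ⟨0, scalar r⟩
  | ha x y hx hy =>
    obtain ⟨m, hx⟩ := hx
    obtain ⟨m', hy⟩ := hy
    exact ⟨max m m', (hx.mono (le_max_left _ _)).add (hy.mono (le_max_right _ _))⟩
  | hm v x hx =>
    obtain ⟨m, hx⟩ := hx
    induction v using Finsupp.induction_linear with
    | zero => exact ⟨m, by simpa using zero⟩
    | add v w hv hw =>
      obtain ⟨m, hv⟩ := hv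
      obtain ⟨m', hw⟩ := hw
      rw [map_add, add_mul]
      exact ⟨max m m', (hv.mono (le_max_left _ _)).add (hw.mono (le_max_right _ _))⟩
    | single j r =>
      rw [← mul_one r, ← smul_eq_mul r, ← Finsupp.smul_single, map_smul, smul_mul_assoc]
      exact ⟨max m (j.1 + 1), (ι_mul j (by omega) (hx.mono (le_max_left _ _))).smul r⟩

lemma zero_iff (hx : InitialPart R N 0 x) : ∃ r, x = algebraMap R _ r := by
  induction hx with
  | scalar t => exact ⟨t, rfl⟩
  | add _ _ hx hy =>
    obtain ⟨r, rfl⟩ := hx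
    obtain ⟨r', rfl⟩ := hy
    exact ⟨r + r', (map_add _ _ _).symm⟩
  | ι_mul j hj => exact absurd hj (Nat.not_lt_zero _)

lemma exists_eq_add (hm : (m : ℕ∞) < N) (hx : InitialPart R N (m + 1) x) :
    ∃ a b, InitialPart R N m a ∧ InitialPart R N m b ∧
      x = a + ExteriorAlgebra.ι R (Finsupp.single ⟨m, hm⟩ 1) * b := by
  induction hx with
  | scalar r => exact ⟨_, 0, scalar r, zero, by simp⟩
  | add _ _ hx hy =>
    obtain ⟨a, b, ha, hb, rfl⟩ := hx
    obtain ⟨a', b', ha', hb', rfl⟩ := hy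
    exact ⟨a + a', b + b', ha.add ha', hb.add hb', by rw [mul_add]; abel⟩
  | ι_mul j hj _ hx =>
    obtain ⟨a, b, ha, hb, rfl⟩ := hx
    rcases Nat.lt_succ_iff_lt_or_eq.1 hj with h | h
    · refine ⟨_, _, ha.ι_mul j h, (hb.ι_mul j h).neg, ?_⟩
      have := ExteriorAlgebra.ι_add_mul_swap (R := R) (Finsupp.single j (1 : R))
        (Finsupp.single ⟨m, hm⟩ (1 : R))
      rw [mul_add, ← mul_assoc, eq_neg_of_add_eq_zero_left this]
      simp [mul_assoc]
    · obtain rfl : j = ⟨m, hm⟩ := Subtype.ext h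
      refine ⟨0, a, zero, ha, ?_⟩
      rw [mul_add, ← mul_assoc, ExteriorAlgebra.ι_sq_zero]
      simp

lemma succ_of_le (hm : N ≤ (m : ℕ∞)) (hx : InitialPart R N (m + 1) x) : InitialPart R N m x := by
  induction hx with
  | scalar t => exact scalar _
  | add _ _ hx hy => exact add hx hy
  | ι_mul j _ _ hx => exact ι_mul j (by exact_mod_cast j.2.trans_le hm) hx

end InitialPart

variable (u : {i : ℕ // (i : ℕ∞) < N} → R)

section General

variable {ι : Type v} (u : ι → R)

lemma koszulD_algebraMap (r : R) : koszulD u (algebraMap R _ r) = 0 :=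
  CliffordAlgebra.contractLeft_algebraMap _ _ _

lemma koszulD_ι_mul (v : ι →₀ R) (x : KoszulAlg R ι) :
    koszulD u (ExteriorAlgebra.ι R v * x) =
      toU u v • x - ExteriorAlgebra.ι R v * koszulD u x :=
  CliffordAlgebra.contractLeft_ι_mul _ _ _

lemma koszulD_koszulD (x : KoszulAlg R ι) : koszulD u (koszulD u x) = 0 :=
  CliffordAlgebra.contractLeft_contractLeft _ _

@[simp] lemma toU_single (i : ι) : toU u (Finsupp.single i 1) = u i := by
  simp [toU]

end General

lemma InitialPart.koszulD {m : ℕ} {x} (hx : InitialPart R N m x) :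
    InitialPart R N m (koszulD u x) := by
  induction hx with
  | scalar t => rw [koszulD_algebraMap]; exact zero
  | add _ _ hx hy => rw [map_add]; exact add hx hy
  | ι_mul j hj h hx => rw [koszulD_ι_mul]; exact (h.smul _).sub (ι_mul j hj hx)

/-- Contraction with the coordinate function of `eₘ` kills the part generated by the earlier
generators. -/
lemma InitialPart.contract_eq_zero {m : ℕ} (hm : (m : ℕ∞) < N) {x} (hx : InitialPart R N m x) :
    RegularQuotient.koszulD (R := R) (Pi.single ⟨m, hm⟩ 1) x = 0 := by
  induction hx with
  | scalar t => rw [koszulD_algebraMap]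
  | add _ _ hx hy => rw [map_add, hx, hy, add_zero]
  | @ι_mul j hj x h hx =>
    rw [koszulD_ι_mul, hx, toU_single, Pi.single_eq_of_ne, zero_smul, mul_zero, sub_zero]
    rintro rfl
    exact lt_irrefl _ hj

lemma InitialPart.eq_zero_of_add_eq_zero {m : ℕ} (hm : (m : ℕ∞) < N) {a b}
    (ha : InitialPart R N m a) (hb : InitialPart R N m b)
    (h : a + ExteriorAlgebra.ι R (Finsupp.single ⟨m, hm⟩ 1) * b = 0) : a = 0 ∧ b = 0 := by
  have := congrArg (RegularQuotient.koszulD (R := R) (Pi.single ⟨m, hm⟩ 1)) h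
  rw [map_add, koszulD_ι_mul, ha.contract_eq_zero hm, hb.contract_eq_zero hm, toU_single] at this
  have hb0 : b = 0 := by simpa using this
  subst hb0
  simpa using h

/-- The constant term of a Koszul boundary of an element of the part generated by the `eⱼ`, `j < m`,
lies in the ideal of the `uⱼ`, `j < m`. -/
lemma InitialPart.algebraMapInv_koszulD_mem {m : ℕ} (hm : (m : ℕ∞) < N) {x}
    (hx : InitialPart R N m x) :
    ExteriorAlgebra.algebraMapInv (RegularQuotient.koszulD u x) ∈
      Ideal.span (u '' Set.Iio ⟨m, hm⟩) := by
  induction hx with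
  | scalar t => rw [koszulD_algebraMap]; simp
  | add _ _ hx hy => rw [map_add, map_add]; exact add_mem hx hy
  | @ι_mul j hj x h hx =>
    rw [koszulD_ι_mul, map_sub, map_smul, map_mul, toU_single, smul_eq_mul]
    have : ExteriorAlgebra.algebraMapInv (ExteriorAlgebra.ι R (Finsupp.single j (1 : R))) = 0 := by
      simp [ExteriorAlgebra.algebraMapInv]
    rw [this, zero_mul, sub_zero]
    exact Ideal.mul_mem_right _ _ (Ideal.subset_span ⟨j, hj, rfl⟩)

lemma exists_koszulD_eq_algebraMap {m : ℕ} (hm : (m : ℕ∞) < N) {r : R}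
    (hr : r ∈ Ideal.span (u '' Set.Iio ⟨m, hm⟩)) :
    ∃ c, InitialPart R N m c ∧ koszulD u c = algebraMap R _ r := by
  induction hr using Submodule.span_induction with
  | mem x h =>
    obtain ⟨j, hj, rfl⟩ := h
    refine ⟨_, InitialPart.ι_mul j hj (InitialPart.scalar 1), ?_⟩
    rw [koszulD_ι_mul, koszulD_algebraMap, toU_single, mul_zero, sub_zero, Algebra.smul_def,
      ← map_mul, mul_one]
  | zero => exact ⟨algebraMap R _ 0, InitialPart.scalar 0, by rw [koszulD_algebraMap, map_zero]⟩
  | add x y _ _ hx hy =>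
    obtain ⟨c, hc, h⟩ := hx
    obtain ⟨c', hc', h'⟩ := hy
    exact ⟨_, hc.add hc', by rw [map_add, h, h', map_add]⟩
  | smul t x _ hx =>
    obtain ⟨c, hc, h⟩ := hx
    exact ⟨_, hc.smul t, by rw [map_smul, h, smul_eq_mul, map_mul, Algebra.smul_def]⟩

variable {u} in
/-- A cycle of the Koszul complex of a regular sequence with vanishing constant term is a boundary.
A cycle `a + eₘ b` of the complex on the first `m + 1` generators has `d b = 0` and
`d a + uₘ b = 0`. The constant term of `b` lies in `(u₀, …, uₘ₋₁)` by regularity, so that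
`b = d c`, and `a + eₘ b` differs by the boundary `- d (eₘ c)` from the cycle `a + uₘ c`, which
involves the first `m` generators only. -/
lemma InitialPart.exists_koszulD_eq (hu : IsRegularSeq u) (m : ℕ)
    {x : KoszulAlg R {i : ℕ // (i : ℕ∞) < N}} (hx : InitialPart R N m x)
    (h0 : ExteriorAlgebra.algebraMapInv x = 0) (hd : RegularQuotient.koszulD u x = 0) :
    ∃ y, InitialPart R N m y ∧ RegularQuotient.koszulD u y = x := by
  induction m generalizing x with
  | zero =>
    obtain ⟨r, rfl⟩ := hx.zero_iff
    rw [ExteriorAlgebra.algebraMap_leftInverse] at h0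
    subst h0
    exact ⟨0, zero, by simp⟩
  | succ m ih =>
    by_cases hm : (m : ℕ∞) < N
    swap
    · obtain ⟨y, hy, hyx⟩ := ih (hx.succ_of_le (not_lt.1 hm)) h0 hd
      exact ⟨y, hy.mono m.le_succ, hyx⟩
    obtain ⟨a, b, ha, hb, rfl⟩ := hx.exists_eq_add hm
    set e := ExteriorAlgebra.ι R (Finsupp.single (⟨m, hm⟩ : {i : ℕ // (i : ℕ∞) < N}) (1 : R))
      with he
    have hεe : ∀ z, ExteriorAlgebra.algebraMapInv (e * z) = 0 := fun z => by
      rw [map_mul, he]; simp [ExteriorAlgebra.algebraMapInv]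
    have hde : ∀ z, RegularQuotient.koszulD u (e * z) =
        u ⟨m, hm⟩ • z - e * RegularQuotient.koszulD u z := fun z => by
      rw [he, koszulD_ι_mul, toU_single]
    rw [map_add, hεe, add_zero] at h0
    rw [map_add, hde, ← add_sub_assoc, sub_eq_add_neg, ← mul_neg] at hd
    obtain ⟨h1, h2⟩ := ((ha.koszulD u).add (hb.smul _)).eq_zero_of_add_eq_zero hm
      (hb.koszulD u).neg hd
    rw [neg_eq_zero] at h2
    have h3 : ExteriorAlgebra.algebraMapInv b ∈ Ideal.span (u '' Set.Iio ⟨m, hm⟩) := by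
      have h4 := congrArg ExteriorAlgebra.algebraMapInv h1
      rw [map_add, map_zero, map_smul, add_comm] at h4
      rw [← Ideal.Quotient.eq_zero_iff_mem]
      refine (hu ⟨m, hm⟩).right_eq_zero_of_smul ?_
      rw [← Ideal.Quotient.mk_eq_mk, ← Submodule.Quotient.mk_smul, eq_neg_of_add_eq_zero_left h4,
        Ideal.Quotient.mk_eq_mk, Ideal.Quotient.eq_zero_iff_mem]
      exact neg_mem (ha.algebraMapInv_koszulD_mem u hm)
    obtain ⟨c₁, hc₁, hbc₁⟩ := exists_koszulD_eq_algebraMap u hm h3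
    obtain ⟨c₂, hc₂, hbc₂⟩ := ih (hb.sub (scalar (ExteriorAlgebra.algebraMapInv b)))
      (by rw [map_sub, ExteriorAlgebra.algebraMap_leftInverse, sub_self])
      (by rw [map_sub, h2, koszulD_algebraMap, sub_zero])
    obtain ⟨c, hc, hbc, hεc⟩ : ∃ c, InitialPart R N m c ∧ RegularQuotient.koszulD u c = b ∧
        ExteriorAlgebra.algebraMapInv c = 0 := by
      refine ⟨_, (hc₁.add hc₂).sub (scalar (ExteriorAlgebra.algebraMapInv (c₁ + c₂))), ?_, ?_⟩
      · rw [map_sub, map_add, hbc₁, hbc₂, koszulD_algebraMap]; abel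
      · rw [map_sub, ExteriorAlgebra.algebraMap_leftInverse, sub_self]
    obtain ⟨y, hy, hyx⟩ := ih (x := a + u ⟨m, hm⟩ • c) (ha.add (hc.smul _))
      (by rw [map_add, map_smul, h0, hεc]; simp)
      (by rw [map_add, map_smul, hbc, h1])
    refine ⟨y - e * c, (hy.mono m.le_succ).sub (ι_mul _ m.lt_succ_self (hc.mono m.le_succ)), ?_⟩
    rw [map_sub, hyx, hde, hbc]
    abel

variable {u} in
lemma exists_koszulD_eq (hu : IsRegularSeq u) {x : KoszulAlg R {i : ℕ // (i : ℕ∞) < N}}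
    (h0 : ExteriorAlgebra.algebraMapInv x = 0) (hd : koszulD u x = 0) :
    ∃ y, koszulD u y = x := by
  obtain ⟨m, hm⟩ := InitialPart.exists_mem x
  obtain ⟨y, -, hy⟩ := hm.exists_koszulD_eq hu m h0 hd
  exact ⟨y, hy⟩

end KoszulExact

/-! ### Truncated polynomials and exactness of `K(R; Iˢ)` in positive degrees -/

section Decompose

variable {A : Type u} [CommRing A] {M : Type v} [AddCommGroup M] [Module A M]
  (𝒜 : ℕ → Submodule A M) [DirectSum.Decomposition 𝒜]

lemma decompose_map_apply (f : M →ₗ[A] M) (h : ∀ n x, x ∈ 𝒜 (n + 1) → f x ∈ 𝒜 n)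
    (h0 : ∀ x ∈ 𝒜 0, f x = 0) (y : M) (n : ℕ) :
    (DirectSum.decompose 𝒜 (f y) n : M) = f (DirectSum.decompose 𝒜 y (n + 1)) := by
  induction y using DirectSum.Decomposition.inductionOn 𝒜 with
  | zero => simp
  | @homogeneous i m =>
    cases i with
    | zero =>
      rw [h0 _ m.2, DirectSum.decompose_of_mem_ne 𝒜 m.2 (Nat.succ_ne_zero n).symm]
      simp
    | succ i =>
      by_cases hi : i = n
      · subst hi
        rw [DirectSum.decompose_of_mem_same 𝒜 (h _ _ m.2), DirectSum.decompose_of_mem_same 𝒜 m.2]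
      · rw [DirectSum.decompose_of_mem_ne 𝒜 (h _ _ m.2) hi,
          DirectSum.decompose_of_mem_ne 𝒜 m.2 (by omega), map_zero]
  | add a b ha hb => simp only [map_add, DirectSum.decompose_add, DirectSum.add_apply,
      Submodule.coe_add, ha, hb]

/-- If a homogeneous element is the image of some element under a map of degree `-1`, then it is the
image of a homogeneous element. -/
lemma exists_mem_of_map_eq (f : M →ₗ[A] M) (h : ∀ n x, x ∈ 𝒜 (n + 1) → f x ∈ 𝒜 n)
    (h0 : ∀ x ∈ 𝒜 0, f x = 0) {n : ℕ} {x y : M} (hx : x ∈ 𝒜 n) (hy : f y = x) :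
    ∃ y' ∈ 𝒜 (n + 1), f y' = x :=
  ⟨_, SetLike.coe_mem (DirectSum.decompose 𝒜 y (n + 1)), by
    rw [← decompose_map_apply 𝒜 f h h0, hy, DirectSum.decompose_of_mem_same 𝒜 hx]⟩

end Decompose

section Koszul

variable {R : Type u} [CommRing R]

lemma koszulD_mem {ι : Type v} (u : ι → R) (n : ℕ) (x : KoszulAlg R ι)
    (hx : x ∈ ⋀[R]^(n + 1) (ι →₀ R)) : koszulD u x ∈ ⋀[R]^n (ι →₀ R) := by
  induction n generalizing x with
  | zero =>
    rw [zero_add, extPow_eq, pow_one] at hx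
    obtain ⟨v, rfl⟩ := hx
    rw [← mul_one (ExteriorAlgebra.ι R v), koszulD_ι_mul, ← map_one (algebraMap R _),
      koszulD_algebraMap, mul_zero, sub_zero]
    exact Submodule.smul_mem _ _ (SetLike.algebraMap_mem_graded _ _)
  | succ n ih =>
    rw [extPow_eq, pow_succ'] at hx
    induction hx using Submodule.mul_induction_on' with
    | mem_mul_mem v hv y hy =>
      obtain ⟨v, rfl⟩ := hv
      rw [koszulD_ι_mul]
      refine Submodule.sub_mem _ (Submodule.smul_mem _ _ hy) ?_
      rw [extPow_eq, pow_succ']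
      exact Submodule.mul_mem_mul ⟨v, rfl⟩ (ih y hy)
    | add x _ y _ hx hy => rw [map_add]; exact Submodule.add_mem _ hx hy

lemma koszulD_eq_zero_of_mem {ι : Type v} (u : ι → R) (x : KoszulAlg R ι)
    (hx : x ∈ ⋀[R]^0 (ι →₀ R)) : koszulD u x = 0 := by
  rw [extPow_eq, pow_zero, Submodule.mem_one] at hx
  obtain ⟨r, rfl⟩ := hx
  exact koszulD_algebraMap u r

lemma algebraMapInv_eq_zero_of_mem {V : Type v} [AddCommGroup V] [Module R V] (n : ℕ)
    (x : ExteriorAlgebra R V) (hx : x ∈ ⋀[R]^(n + 1) V) : ExteriorAlgebra.algebraMapInv x = 0 := by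
  rw [extPow_eq, pow_succ'] at hx
  induction hx using Submodule.mul_induction_on' with
  | mem_mul_mem v hv y hy =>
    obtain ⟨v, rfl⟩ := hv
    rw [map_mul]; simp [ExteriorAlgebra.algebraMapInv]
  | add x _ y _ hx hy => rw [map_add, hx, hy, add_zero]

variable {N : ℕ∞} {u : {i : ℕ // (i : ℕ∞) < N} → R}

/-- The Koszul complex of a regular sequence is exact in positive degrees. -/
lemma exists_koszulD_eq_of_mem (hu : IsRegularSeq u) (n : ℕ)
    {x : KoszulAlg R {i : ℕ // (i : ℕ∞) < N}}
    (hx : x ∈ ⋀[R]^(n + 1) ({i : ℕ // (i : ℕ∞) < N} →₀ R)) (hd : koszulD u x = 0) :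
    ∃ y ∈ ⋀[R]^(n + 2) ({i : ℕ // (i : ℕ∞) < N} →₀ R), koszulD u y = x := by
  obtain ⟨y, hy⟩ := exists_koszulD_eq hu (algebraMapInv_eq_zero_of_mem n x hx) hd
  exact exists_mem_of_map_eq (fun n : ℕ => ⋀[R]^n ({i : ℕ // (i : ℕ∞) < N} →₀ R)) _ (koszulD_mem u)
    (koszulD_eq_zero_of_mem u) hx hy

/-- Exactness of the Koszul complex of a regular sequence persists after tensoring with a flat
algebra. -/
lemma exists_baseChange_koszulD_eq (hu : IsRegularSeq u) (T : Type w) [CommRing T] [Algebra R T]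
    [Module.Flat R T] (n : ℕ) {z : T ⊗[R] KoszulAlg R {i : ℕ // (i : ℕ∞) < N}}
    (hz : z ∈ (⋀[R]^(n + 1) ({i : ℕ // (i : ℕ∞) < N} →₀ R)).baseChange T)
    (hd : (koszulD u).baseChange T z = 0) :
    ∃ y ∈ (⋀[R]^(n + 2) ({i : ℕ // (i : ℕ∞) < N} →₀ R)).baseChange T,
      (koszulD u).baseChange T y = z := by
  obtain ⟨w, rfl⟩ := hz
  let δ (n : ℕ) : ⋀[R]^(n + 1) ({i : ℕ // (i : ℕ∞) < N} →₀ R) →ₗ[R]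
      ⋀[R]^n ({i : ℕ // (i : ℕ∞) < N} →₀ R) := (koszulD u).restrict (koszulD_mem u n)
  have hδ (n : ℕ) (t : T ⊗[R] ⋀[R]^(n + 1) ({i : ℕ // (i : ℕ∞) < N} →₀ R)) :
      (koszulD u).baseChange T ((Submodule.subtype _).baseChange T t) =
        (Submodule.subtype _).lTensor T ((δ n).lTensor T t) := by
    induction t using TensorProduct.induction_on with
    | zero => simp
    | tmul t x => rfl
    | add a b ha hb => simp only [map_add, ha, hb]
  have hex : Function.Exact (δ (n + 1)) (δ n) := by
    intro x
    constructor
    · intro h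
      obtain ⟨y, hy, hyx⟩ := exists_koszulD_eq_of_mem hu n x.2 (congrArg Subtype.val h)
      exact ⟨⟨y, hy⟩, Subtype.ext hyx⟩
    · rintro ⟨y, rfl⟩
      exact Subtype.ext (koszulD_koszulD u _)
  rw [hδ] at hd
  have h0 := (injective_iff_map_eq_zero _).1 (Module.Flat.lTensor_preserves_injective_linearMap
    (M := T) (Submodule.subtype _) Subtype.val_injective) _ hd
  obtain ⟨y, rfl⟩ := (Module.Flat.lTensor_exact T hex w).1 h0
  exact ⟨_, ⟨y, rfl⟩, hδ (n + 1) y⟩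

end Koszul

section TruncPoly

open MvPolynomial

variable (R : Type u) [CommRing R] (ι : Type v) (s : ℕ)

/-- The quotient map from polynomials to truncated polynomials, as an `R`-linear map. -/
def truncMk : MvPolynomial ι R →ₗ[R] TruncPoly R ι s :=
  (Ideal.Quotient.mkₐ R (idealOfVars ι R ^ s)).toLinearMap

/-- The homogeneous component of degree `k < s` of a truncated polynomial, as a polynomial. -/
def truncLift (k : ℕ) (hk : k < s) : TruncPoly R ι s →ₗ[R] MvPolynomial ι R :=
  Submodule.liftQ ((idealOfVars ι R ^ s).restrictScalars R) (homogeneousComponent k)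
    (fun p hp => by
      rw [LinearMap.mem_ker]
      ext d
      rw [coeff_homogeneousComponent, coeff_zero]
      split_ifs with h
      · exact (mem_pow_idealOfVars_iff' s p).1 hp d (h ▸ hk)
      · rfl) ∘ₗ
    (Submodule.Quotient.restrictScalarsEquiv R (idealOfVars ι R ^ s)).symm.toLinearMap

variable {R ι}

lemma truncMk_surjective : Function.Surjective (truncMk R ι s) := Ideal.Quotient.mk_surjective

@[simp] lemma truncLift_truncMk (k : ℕ) (hk : k < s) (p : MvPolynomial ι R) :
    truncLift R ι s k hk (truncMk R ι s p) = homogeneousComponent k p := rfl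

lemma sum_truncLift (t : TruncPoly R ι s) :
    truncMk R ι s (∑ k : Fin s, truncLift R ι s k k.2 t) = t := by
  obtain ⟨p, rfl⟩ := truncMk_surjective s t
  simp only [truncLift_truncMk]
  refine Ideal.Quotient.eq.2 ((mem_pow_idealOfVars_iff' s _).2 fun d hd => ?_)
  rw [coeff_sub, coeff_sum]
  simp only [coeff_homogeneousComponent]
  rw [Finset.sum_eq_single ⟨d.degree, hd⟩]
  · simp
  · intro b _ hb
    exact if_neg fun h => hb (Fin.ext h.symm)
  · simp

instance : Module.Projective R (TruncPoly R ι s) :=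
  Module.Projective.of_split (∑ k : Fin s, truncLift R ι s k k.2) (truncMk R ι s)
    (LinearMap.ext fun t => by
      simpa using sum_truncLift s t)

/-- The projection of truncated polynomials onto the homogeneous part of degree `k`. -/
def truncProj (k : ℕ) : TruncPoly R ι s →ₗ[R] TruncPoly R ι s :=
  if hk : k < s then truncMk R ι s ∘ₗ truncLift R ι s k hk else 0

lemma truncProj_truncMk (k : ℕ) (p : MvPolynomial ι R) :
    truncProj s k (truncMk R ι s p) = truncMk R ι s (homogeneousComponent k p) := by
  rw [truncProj]
  split_ifs with hk
  · rfl
  · refine (Ideal.Quotient.eq_zero_iff_mem.2 ((mem_pow_idealOfVars_iff' s _).2 fun d hd => ?_)).symm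
    rw [coeff_homogeneousComponent, if_neg (by omega)]

lemma sum_truncProj (t : TruncPoly R ι s) : ∑ k ∈ Finset.range s, truncProj s k t = t := by
  conv_rhs => rw [← sum_truncLift s t, map_sum]
  rw [Finset.sum_range]
  refine Finset.sum_congr rfl fun k _ => ?_
  rw [truncProj, dif_pos k.2]
  rfl

lemma truncProj_truncProj (j k : ℕ) (t : TruncPoly R ι s) :
    truncProj s j (truncProj s k t) = if j = k then truncProj s k t else 0 := by
  obtain ⟨p, rfl⟩ := truncMk_surjective s t
  rw [truncProj_truncMk, truncProj_truncMk, homogeneousComponent_of_mem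
    (homogeneousComponent_mem k p), apply_ite (truncMk R ι s), map_zero]

lemma homogeneousComponent_succ_X_mul (k : ℕ) (i : ι) (p : MvPolynomial ι R) :
    homogeneousComponent (k + 1) (X i * p) = X i * homogeneousComponent k p := by
  classical
  induction p using MvPolynomial.induction_on' with
  | monomial d r =>
    have h : X i * monomial d r = monomial (Finsupp.single i 1 + d) r := by
      rw [X, monomial_mul, one_mul]
    rw [h, homogeneousComponent_of_mem ((mem_homogeneousSubmodule _ _).2
        (isHomogeneous_monomial r rfl)), homogeneousComponent_of_mem
        ((mem_homogeneousSubmodule _ _).2 (isHomogeneous_monomial r rfl))]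
    simp only [map_add, Finsupp.degree_single, mul_ite, mul_zero, h]
    exact if_congr (by omega) rfl rfl
  | add p q hp hq => rw [mul_add, map_add, hp, hq, map_add, mul_add]

lemma homogeneousComponent_zero_X_mul (i : ι) (p : MvPolynomial ι R) :
    homogeneousComponent 0 (X i * p) = 0 := by
  rw [homogeneousComponent_zero, ← constantCoeff_eq, map_mul, constantCoeff_X, zero_mul, map_zero]

lemma truncProj_succ_toUTilde_mul (k : ℕ) (v : ι →₀ R) (t : TruncPoly R ι s) :
    truncProj s (k + 1) (toUTilde R ι s v * t) = toUTilde R ι s v * truncProj s k t := by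
  induction v using Finsupp.induction_linear with
  | zero => simp
  | add v w hv hw => rw [map_add, add_mul, map_add, hv, hw, add_mul]
  | single i r =>
    obtain ⟨p, rfl⟩ := truncMk_surjective s t
    rw [toUTilde, Finsupp.linearCombination_single, smul_mul_assoc, smul_mul_assoc, map_smul,
      truncProj_truncMk]
    congr 1
    refine (truncProj_truncMk s (k + 1) (X i * p)).trans ?_
    rw [homogeneousComponent_succ_X_mul]
    exact map_mul (Ideal.Quotient.mkₐ R (idealOfVars ι R ^ s)) _ _

lemma truncProj_zero_toUTilde_mul (v : ι →₀ R) (t : TruncPoly R ι s) :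
    truncProj s 0 (toUTilde R ι s v * t) = 0 := by
  induction v using Finsupp.induction_linear with
  | zero => simp
  | add v w hv hw => rw [map_add, add_mul, map_add, hv, hw, add_zero]
  | single i r =>
    obtain ⟨p, rfl⟩ := truncMk_surjective s t
    rw [toUTilde, Finsupp.linearCombination_single, smul_mul_assoc, map_smul]
    refine (congrArg (r • ·) ((truncProj_truncMk s 0 (X i * p)).trans ?_)).trans (smul_zero r)
    rw [homogeneousComponent_zero_X_mul, map_zero]

end TruncPoly

section RTensor

variable {R : Type u} [CommRing R] {V : Type v} [AddCommGroup V] [Module R V] {T : Type w}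
  [CommRing T] [Algebra R T]

lemma rTensor_ι_mul (f : T →ₗ[R] T) (v : V) (z : T ⊗[R] ExteriorAlgebra R V) :
    f.rTensor _ ((1 ⊗ₜ ExteriorAlgebra.ι R v) * z) =
      (1 ⊗ₜ ExteriorAlgebra.ι R v) * f.rTensor _ z := by
  induction z using TensorProduct.induction_on with
  | zero => simp
  | tmul t x => simp
  | add a b ha hb => simp only [mul_add, map_add, ha, hb]

lemma rTensor_smul_contractInto (f g : T →ₗ[R] T) (θ : V →ₗ[R] T)
    (h : ∀ v t, f (θ v * t) = θ v * g t) (t : T) (x : ExteriorAlgebra R V) :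
    f.rTensor _ (t • contractInto θ x) = g t • contractInto θ x := by
  induction x using ext_induction with
  | hr r => simp
  | ha x y hx hy => simp only [map_add, smul_add, hx, hy]
  | hm v x hx =>
    rw [contractInto_ι_mul, smul_sub, smul_sub, map_sub, ← mul_smul_comm, ← mul_smul_comm,
      rTensor_ι_mul, hx, TensorProduct.smul_tmul', TensorProduct.smul_tmul', LinearMap.rTensor_tmul,
      smul_eq_mul, smul_eq_mul, mul_comm t, h, mul_comm]

lemma rTensor_smul_contractInto_eq_zero (f : T →ₗ[R] T) (θ : V →ₗ[R] T)
    (h : ∀ v t, f (θ v * t) = 0) (t : T) (x : ExteriorAlgebra R V) :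
    f.rTensor _ (t • contractInto θ x) = 0 := by
  rw [rTensor_smul_contractInto f 0 θ (fun v t => by rw [h, LinearMap.zero_apply, mul_zero]),
    LinearMap.zero_apply, zero_smul]

end RTensor

section Weight

variable {R : Type u} [CommRing R] {ι : Type v} (s : ℕ)

/-- The projection of `⨁_{k<s} K ⊗ U⁽ᵏ⁾` onto `K ⊗ U⁽ᵏ⁾`. -/
def weightProj (k : ℕ) :
    TruncPoly R ι s ⊗[R] KoszulAlg R ι →ₗ[R] TruncPoly R ι s ⊗[R] KoszulAlg R ι :=
  (truncProj s k).rTensor (KoszulAlg R ι)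

@[simp] lemma weightProj_tmul (k : ℕ) (t : TruncPoly R ι s) (x : KoszulAlg R ι) :
    weightProj s k (t ⊗ₜ x) = truncProj s k t ⊗ₜ x := rfl

lemma sum_weightProj (z : TruncPoly R ι s ⊗[R] KoszulAlg R ι) :
    ∑ k ∈ Finset.range s, weightProj s k z = z := by
  induction z using TensorProduct.induction_on with
  | zero => simp
  | tmul t x => simp only [weightProj_tmul, ← TensorProduct.sum_tmul, sum_truncProj]
  | add a b ha hb => simp only [map_add, Finset.sum_add_distrib, ha, hb]

lemma weightProj_weightProj (j k : ℕ) (z : TruncPoly R ι s ⊗[R] KoszulAlg R ι) :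
    weightProj s j (weightProj s k z) = if j = k then weightProj s k z else 0 := by
  induction z using TensorProduct.induction_on with
  | zero => simp
  | tmul t x =>
    rw [weightProj_tmul, weightProj_tmul, truncProj_truncProj]
    split_ifs <;> simp
  | add a b ha hb =>
    simp only [map_add, ha, hb]
    split_ifs <;> simp

lemma weightProj_dQ (u : ι → R) (k : ℕ) (z : TruncPoly R ι s ⊗[R] KoszulAlg R ι) :
    weightProj s k (dQ u s z) = dQ u s (weightProj s k z) := by
  induction z using TensorProduct.induction_on with
  | zero => simp
  | tmul t x => rfl
  | add a b ha hb => simp only [map_add, ha, hb]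

lemma weightProj_mem (k n : ℕ) {z : TruncPoly R ι s ⊗[R] KoszulAlg R ι}
    (hz : z ∈ (⋀[R]^n (ι →₀ R)).baseChange (TruncPoly R ι s)) :
    weightProj s k z ∈ (⋀[R]^n (ι →₀ R)).baseChange (TruncPoly R ι s) := by
  obtain ⟨w, rfl⟩ := hz
  induction w using TensorProduct.induction_on with
  | zero => simp
  | tmul t x => exact Submodule.tmul_mem_baseChange_of_mem _ x.2
  | add a b ha hb => rw [map_add, map_add]; exact add_mem ha hb

lemma weightProj_succ_del (k : ℕ) (z : TruncPoly R ι s ⊗[R] KoszulAlg R ι) :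
    weightProj s (k + 1) (del R ι s z) = del R ι s (weightProj s k z) := by
  induction z using TensorProduct.induction_on with
  | zero => simp
  | tmul t x =>
    exact rTensor_smul_contractInto _ _ _ (truncProj_succ_toUTilde_mul s k) t x
  | add a b ha hb => simp only [map_add, ha, hb]

lemma weightProj_zero_del (z : TruncPoly R ι s ⊗[R] KoszulAlg R ι) :
    weightProj s 0 (del R ι s z) = 0 := by
  induction z using TensorProduct.induction_on with
  | zero => simp
  | tmul t x =>
    exact rTensor_smul_contractInto_eq_zero _ _ (truncProj_zero_toUTilde_mul s) t x
  | add a b ha hb => simp only [map_add, ha, hb, add_zero]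

/-- `∂` raises the weight. -/
lemma weightProj_del_eq_zero {k : ℕ} {z : TruncPoly R ι s ⊗[R] KoszulAlg R ι}
    (hz : ∀ j < k, weightProj s j z = 0) {j : ℕ} (hj : j ≤ k) :
    weightProj s j (del R ι s z) = 0 := by
  cases j with
  | zero => exact weightProj_zero_del s z
  | succ j => rw [weightProj_succ_del, hz j hj, map_zero]

variable {N : ℕ∞} {u : {i : ℕ // (i : ℕ∞) < N} → R}

/-- A cycle without components of weight less than `k` is a boundary. Its component of weight `k` is
a cycle for `d_Q`, hence a boundary `d_Q w`, and subtracting the boundary of `w` leaves a cycle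
without components of weight less than `k + 1`. -/
lemma exists_dQ_add_del_eq (hu : IsRegularSeq u) (n k r : ℕ) (hk : k + r = s)
    {z : TruncPoly R {i : ℕ // (i : ℕ∞) < N} s ⊗[R] KoszulAlg R {i : ℕ // (i : ℕ∞) < N}}
    (hz : z ∈ (⋀[R]^(n + 1) ({i : ℕ // (i : ℕ∞) < N} →₀ R)).baseChange (TruncPoly R _ s))
    (hd : dQ u s z + del R _ s z = 0) (h0 : ∀ j < k, weightProj s j z = 0) :
    ∃ y ∈ (⋀[R]^(n + 2) ({i : ℕ // (i : ℕ∞) < N} →₀ R)).baseChange (TruncPoly R _ s),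
      dQ u s y + del R _ s y = z := by
  induction r generalizing k z with
  | zero =>
    refine ⟨0, zero_mem _, ?_⟩
    rw [map_zero, map_zero, add_zero, ← sum_weightProj s z]
    exact (Finset.sum_eq_zero fun j hj => h0 j (by rw [Finset.mem_range] at hj; omega)).symm
  | succ r ih =>
    have h1 : dQ u s (weightProj s k z) = 0 := by
      rw [← weightProj_dQ, eq_neg_of_add_eq_zero_left hd, map_neg,
        weightProj_del_eq_zero s h0 le_rfl, neg_zero]
    obtain ⟨y, hy, hyz⟩ := exists_baseChange_koszulD_eq hu (TruncPoly R _ s) n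
      (weightProj_mem s k (n + 1) hz) h1
    set w := weightProj s k y with hw
    have hwm := weightProj_mem s k (n + 2) hy
    have hdw : dQ u s w = weightProj s k z := by
      rw [← weightProj_dQ]
      refine (congrArg _ hyz).trans ?_
      rw [weightProj_weightProj, if_pos rfl]
    have hDD : dQ u s (dQ u s w + del R _ s w) + del R _ s (dQ u s w + del R _ s w) = 0 :=
      (koszulPow u s).d_d w
    have hDm : dQ u s w + del R _ s w ∈
        (⋀[R]^(n + 1) ({i : ℕ // (i : ℕ∞) < N} →₀ R)).baseChange (TruncPoly R _ s) :=
      (koszulPow u s).d_mem (n + 1) w hwm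
    obtain ⟨y', hy', hyz'⟩ := ih (k + 1) (by omega) (z := z - (dQ u s w + del R _ s w))
      (sub_mem hz hDm) (by rw [map_sub, map_sub, sub_add_sub_comm, hd, hDD, sub_zero])
      (fun j hj => by
        have h2 : ∀ i < k, weightProj s i w = 0 := fun i hi => by
          rw [hw, weightProj_weightProj, if_neg hi.ne]
        rw [map_sub, map_add, weightProj_del_eq_zero s h2 (Nat.lt_succ_iff.1 hj), hdw,
          weightProj_weightProj, add_zero]
        split_ifs with h
        · rw [h, sub_self]
        · rw [h0 j (by omega), sub_zero])
    exact ⟨y' + w, add_mem hy' hwm, by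
      rw [map_add, map_add, add_add_add_comm, hyz', sub_add_cancel]⟩

/-- The complex `K(R; Iˢ)` is exact in positive degrees. -/
lemma koszulPow_exact_succ (hu : IsRegularSeq u) (n : ℕ) {z : (koszulPow u s).carrier}
    (hz : z ∈ (koszulPow u s).deg (n + 1)) (hd : (koszulPow u s).d z = 0) :
    ∃ y ∈ (koszulPow u s).deg (n + 2), (koszulPow u s).d y = z :=
  exists_dQ_add_del_eq s hu n 0 s (zero_add s) hz hd
    fun j hj => absurd hj (Nat.not_lt_zero j)

end Weight

/-! ### The augmentation of `K(R; Iˢ)` -/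

section ContractDegreeOne

variable {R : Type u} [CommRing R] {V : Type v} [AddCommGroup V] [Module R V] {T : Type w}
  [CommRing T] [Algebra R T]

lemma contractExt_tmul_ι (θ : V →ₗ[R] T) (t : T) (v : V) :
    contractExt θ (t ⊗ₜ ExteriorAlgebra.ι R v) = (t * θ v) ⊗ₜ 1 := by
  rw [contractExt_tmul, ← mul_one (ExteriorAlgebra.ι R v), contractInto_ι_mul,
    ← map_one (algebraMap R _), contractInto_algebraMap, mul_zero, sub_zero,
    TensorProduct.smul_tmul', smul_eq_mul]

lemma exists_eq_tmul_one_of_mem {z : T ⊗[R] ExteriorAlgebra R V}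
    (hz : z ∈ (⋀[R]^0 V).baseChange T) : ∃ t : T, z = t ⊗ₜ 1 := by
  obtain ⟨w, rfl⟩ := hz
  induction w using TensorProduct.induction_on with
  | zero => exact ⟨0, by simp⟩
  | tmul t x =>
    obtain ⟨x, hx⟩ := x
    obtain ⟨r, rfl⟩ := Submodule.mem_one.1 (by rwa [extPow_eq, pow_zero] at hx)
    refine ⟨r • t, ?_⟩
    rw [LinearMap.baseChange_tmul, TensorProduct.smul_tmul, ← Algebra.algebraMap_eq_smul_one]
    rfl
  | add a b ha hb =>
    obtain ⟨t, ht⟩ := ha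
    obtain ⟨t', ht'⟩ := hb
    exact ⟨t + t', by rw [map_add, ht, ht', TensorProduct.add_tmul]⟩

lemma exists_contractExt_eq_tmul_one (θ : V →ₗ[R] T) {t : T} (ht : t ∈ Ideal.span (Set.range θ)) :
    ∃ y ∈ (⋀[R]^1 V).baseChange T, contractExt θ y = t ⊗ₜ 1 := by
  induction ht using Submodule.span_induction with
  | mem x h =>
    obtain ⟨v, rfl⟩ := h
    refine ⟨1 ⊗ₜ ExteriorAlgebra.ι R v, Submodule.tmul_mem_baseChange_of_mem _ ?_, ?_⟩
    · rw [extPow_eq, pow_one]; exact ⟨v, rfl⟩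
    · rw [contractExt_tmul_ι, one_mul]
  | zero => exact ⟨0, zero_mem _, by simp⟩
  | add x y _ _ hx hy =>
    obtain ⟨c, hc, h⟩ := hx
    obtain ⟨c', hc', h'⟩ := hy
    exact ⟨_, add_mem hc hc', by rw [map_add, h, h', TensorProduct.add_tmul]⟩
  | smul t x _ hx =>
    obtain ⟨c, hc, h⟩ := hx
    exact ⟨_, Submodule.smul_mem _ t hc, by rw [map_smul, h, TensorProduct.smul_tmul']⟩

/-- The projection `T ⊗ Λ V → T` onto the part of degree zero. -/
def scalarPart (R : Type u) [CommRing R] (V : Type v) [AddCommGroup V] [Module R V] (T : Type w)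
    [CommRing T] [Algebra R T] : T ⊗[R] ExteriorAlgebra R V →ₐ[R] T :=
  ((Algebra.TensorProduct.rid R T T).toAlgHom.restrictScalars R).comp
    (Algebra.TensorProduct.map (AlgHom.id R T) ExteriorAlgebra.algebraMapInv)

lemma scalarPart_tmul_one (t : T) : scalarPart R V T (t ⊗ₜ 1) = t := by
  simp [scalarPart]

lemma scalarPart_contractExt_mem (θ : V →ₗ[R] T) {y : T ⊗[R] ExteriorAlgebra R V}
    (hy : y ∈ (⋀[R]^1 V).baseChange T) :
    scalarPart R V T (contractExt θ y) ∈ Ideal.span (Set.range θ) := by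
  obtain ⟨w, rfl⟩ := hy
  induction w using TensorProduct.induction_on with
  | zero => simp
  | tmul t x =>
    obtain ⟨x, hx⟩ := x
    obtain ⟨v, rfl⟩ : ∃ v, ExteriorAlgebra.ι R v = x := by
      rwa [extPow_eq, pow_one] at hx
    rw [LinearMap.baseChange_tmul, Submodule.subtype_apply, contractExt_tmul_ι, scalarPart_tmul_one]
    exact Ideal.mul_mem_left _ _ (Ideal.subset_span ⟨v, rfl⟩)
  | add a b ha hb => rw [map_add, map_add, map_add]; exact add_mem ha hb

end ContractDegreeOne

section Augmentation

open MvPolynomial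

variable {R : Type u} [CommRing R] {ι : Type v} (u : ι → R) (s : ℕ)

/-- The linear map `eᵢ ↦ uᵢ + ũᵢ`, for which the differential of `K(R; Iˢ)` is the contraction. -/
def toUAddUTilde : (ι →₀ R) →ₗ[R] TruncPoly R ι s :=
  (Algebra.linearMap R (TruncPoly R ι s)) ∘ₗ toU u + toUTilde R ι s

lemma toUAddUTilde_single (i : ι) : toUAddUTilde u s (Finsupp.single i 1) =
    Ideal.Quotient.mk _ (C (u i) + X i) := by
  rw [toUAddUTilde, LinearMap.add_apply, LinearMap.comp_apply, toU_single, toUTilde,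
    Finsupp.linearCombination_single, one_smul, map_add]
  rfl

lemma koszulPow_d_apply (x : TruncPoly R ι s ⊗[R] KoszulAlg R ι) :
    (koszulPow u s).d x = contractExt (toUAddUTilde u s) x :=
  LinearMap.congr_fun (dQ_add_del u s) x

lemma aeval_neg_mem_of_mem {p : MvPolynomial ι R} (hp : p ∈ idealOfVars ι R ^ s) :
    aeval (fun i => - u i) p ∈ Ideal.span (Set.range u) ^ s := by
  have h : idealOfVars ι R ≤ (Ideal.span (Set.range u)).comap (aeval (R := R) fun i => - u i) := by
    rw [Ideal.span_le]
    rintro _ ⟨i, rfl⟩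
    rw [SetLike.mem_coe, Ideal.mem_comap, aeval_X]
    exact neg_mem (Ideal.subset_span ⟨i, rfl⟩)
  exact Ideal.le_comap_pow _ _ (Ideal.pow_right_mono h s hp)

/-- The map `ũᵢ ↦ - uᵢ` from truncated polynomials to `R / Iˢ`. The sign makes `uᵢ + ũᵢ`, which is
the differential of `eᵢ`, go to zero. -/
def truncAug : TruncPoly R ι s →ₐ[R] R ⧸ Ideal.span (Set.range u) ^ s :=
  Ideal.Quotient.liftₐ _ ((Ideal.Quotient.mkₐ R _).comp (aeval fun i => - u i)) fun _ hp =>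
    Ideal.Quotient.eq_zero_iff_mem.2 (aeval_neg_mem_of_mem u s hp)

lemma truncAug_mk (p : MvPolynomial ι R) :
    truncAug u s (Ideal.Quotient.mk _ p) = Ideal.Quotient.mk _ (aeval (fun i => - u i) p) := rfl

lemma truncAug_toUAddUTilde (v : ι →₀ R) : truncAug u s (toUAddUTilde u s v) = 0 := by
  induction v using Finsupp.induction_linear with
  | zero => simp
  | add v w hv hw => rw [map_add, map_add, hv, hw, add_zero]
  | single i r =>
    rw [← mul_one r, ← smul_eq_mul r, ← Finsupp.smul_single, map_smul, map_smul,
      toUAddUTilde_single, truncAug_mk]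
    simp

/-- An algebra map that takes `Xᵢ` to `- uᵢ` and kills the monomials of degree `s` kills every
polynomial whose value at `- u` lies in `Iˢ`: it takes `Iˢ` into the `s`-th power of the ideal
generated by the images of the `Xᵢ`. -/
lemma map_eq_zero_of_aeval_neg_mem {S : Type w} [CommRing S] [Algebra R S]
    (q : MvPolynomial ι R →ₐ[R] S) (hX : ∀ i, algebraMap R S (u i) + q (X i) = 0)
    (hs : ∀ f ∈ idealOfVars ι R ^ s, q f = 0) {p : MvPolynomial ι R}
    (hp : aeval (fun i => - u i) p ∈ Ideal.span (Set.range u) ^ s) : q p = 0 := by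
  have hX' : ∀ i, q (X i) = algebraMap R _ (- u i) := fun i => by
    rw [map_neg]
    exact eq_neg_of_add_eq_zero_right (hX i)
  have hq : q p = algebraMap R _ (aeval (fun i => - u i) p) := by
    have : q = (Algebra.ofId R _).comp (aeval (R := R) fun i => - u i) :=
      MvPolynomial.algHom_ext fun i => by
        rw [hX', AlgHom.comp_apply, aeval_X]; rfl
    exact DFunLike.congr_fun this p
  have hI : Ideal.span (Set.range u) ≤ ((idealOfVars ι R).map q).comap (algebraMap R S) := by
    rw [Ideal.span_le]
    rintro _ ⟨i, rfl⟩
    rw [SetLike.mem_coe, Ideal.mem_comap, ← neg_neg (u i), map_neg, ← hX']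
    exact neg_mem (Ideal.mem_map_of_mem _ (Ideal.subset_span ⟨i, rfl⟩))
  have hz : (idealOfVars ι R).map q ^ s = ⊥ := by
    rw [← Ideal.map_pow, Ideal.map_eq_bot_iff_le_ker]
    exact hs
  have := Ideal.le_comap_pow _ _ (Ideal.pow_right_mono hI s hp)
  rwa [hz, Ideal.mem_comap, Ideal.mem_bot, ← hq] at this

lemma map_mem_of_aeval_neg_mem {T : Type w} [CommRing T] [Algebra R T]
    (π : MvPolynomial ι R →ₐ[R] T) (J : Ideal T) (hJ : ∀ i, π (C (u i) + X i) ∈ J)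
    (hs : ∀ f ∈ idealOfVars ι R ^ s, π f = 0) {p : MvPolynomial ι R}
    (hp : aeval (fun i => - u i) p ∈ Ideal.span (Set.range u) ^ s) : π p ∈ J := by
  refine Ideal.Quotient.eq_zero_iff_mem.1 (map_eq_zero_of_aeval_neg_mem u s
    ((Ideal.Quotient.mkₐ R J).comp π) (fun i => ?_) (fun f hf => ?_) hp)
  · rw [← AlgHom.commutes ((Ideal.Quotient.mkₐ R J).comp π), ← map_add]
    exact Ideal.Quotient.eq_zero_iff_mem.2 (hJ i)
  · rw [AlgHom.comp_apply, hs f hf, map_zero]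

/-- The kernel of the augmentation is generated by the `uᵢ + ũᵢ`. -/
lemma mem_span_of_truncAug_eq_zero {t : TruncPoly R ι s} (ht : truncAug u s t = 0) :
    t ∈ Ideal.span (Set.range (toUAddUTilde u s)) := by
  obtain ⟨p, rfl⟩ := Ideal.Quotient.mk_surjective t
  rw [truncAug_mk, Ideal.Quotient.eq_zero_iff_mem] at ht
  exact map_mem_of_aeval_neg_mem u s (Ideal.Quotient.mkₐ R _)
    (Ideal.span (Set.range (toUAddUTilde u s)))
    (fun i => Ideal.subset_span ⟨_, toUAddUTilde_single u s i⟩)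
    (fun f hf => Ideal.Quotient.eq_zero_iff_mem.2 hf) ht

/-- The augmentation `K(R; Iˢ) → R / Iˢ`, which is `ũᵢ ↦ - uᵢ` on the part of degree zero. -/
def koszulAug : TruncPoly R ι s ⊗[R] KoszulAlg R ι →ₐ[R] R ⧸ Ideal.span (Set.range u) ^ s :=
  (truncAug u s).comp (scalarPart R (ι →₀ R) (TruncPoly R ι s))

lemma koszulAug_d {y : (koszulPow u s).carrier} (hy : y ∈ (koszulPow u s).deg 1) :
    koszulAug u s ((koszulPow u s).d y) = 0 := by
  have h1 : Ideal.span (Set.range (toUAddUTilde u s)) ≤ RingHom.ker (truncAug u s) := by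
    rw [Ideal.span_le]
    rintro _ ⟨v, rfl⟩
    exact truncAug_toUAddUTilde u s v
  rw [show (koszulPow u s).d y = contractExt (toUAddUTilde u s) y from koszulPow_d_apply u s y]
  exact h1 (scalarPart_contractExt_mem (toUAddUTilde u s) hy)

lemma koszulAug_surjective (b : R ⧸ Ideal.span (Set.range u) ^ s) :
    ∃ z ∈ (koszulPow u s).deg 0, koszulAug u s z = b := by
  obtain ⟨r, rfl⟩ := Ideal.Quotient.mk_surjective b
  refine ⟨algebraMap R _ r, SetLike.algebraMap_mem_graded (koszulPow u s).deg r, ?_⟩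
  exact (koszulAug u s).commutes r

/-- The complex `K(R; Iˢ)` together with its augmentation is exact in degree zero. -/
lemma koszulPow_exact_zero {z : (koszulPow u s).carrier} (hz : z ∈ (koszulPow u s).deg 0)
    (h0 : koszulAug u s z = 0) : ∃ y ∈ (koszulPow u s).deg 1, (koszulPow u s).d y = z := by
  obtain ⟨t, rfl⟩ := exists_eq_tmul_one_of_mem hz
  have ht : t ∈ Ideal.span (Set.range (toUAddUTilde u s)) := by
    refine mem_span_of_truncAug_eq_zero u s ?_
    rw [← h0]
    exact (congrArg (truncAug u s) (scalarPart_tmul_one t)).symm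
  obtain ⟨y, hy, hyt⟩ := exists_contractExt_eq_tmul_one _ ht
  exact ⟨y, hy, (koszulPow_d_apply u s y).trans hyt⟩

lemma koszulPow_deg_projective (n : ℕ) : Module.Projective R ((koszulPow u s).deg n) := by
  have e : TruncPoly R ι s ⊗[R] ⋀[R]^n (ι →₀ R) ≃ₗ[R] (koszulPow u s).deg n :=
    (Submodule.toBaseChange.toLinearEquiv (TruncPoly R ι s) (⋀[R]^n (ι →₀ R))).restrictScalars R
  exact Module.Projective.of_equiv e

end Augmentation

/-! ### Comparison of projective resolutions and of their products -/

section HomologyAt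

variable {A : Type v} [CommRing A] {M₁ M₂ M₃ : Type*} [AddCommGroup M₁] [AddCommGroup M₂]
  [AddCommGroup M₃] [Module A M₁] [Module A M₂] [Module A M₃] {f : M₁ →ₗ[A] M₂} {g : M₂ →ₗ[A] M₃}

lemma HomologyAt.mk_surjective : Function.Surjective (HomologyAt.mk f g) :=
  Submodule.mkQ_surjective _

lemma HomologyAt.mk_eq_mk_iff {x y : LinearMap.ker g} :
    HomologyAt.mk f g x = HomologyAt.mk f g y ↔ ∃ w, f w = (x : M₂) - y :=
  Submodule.Quotient.eq _

variable {M₁' M₂' M₃' : Type*} [AddCommGroup M₁'] [AddCommGroup M₂']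
  [AddCommGroup M₃'] [Module A M₁'] [Module A M₂'] [Module A M₃'] {f' : M₁' →ₗ[A] M₂'}
  {g' : M₂' →ₗ[A] M₃'}

/-- The map on homology induced by a map that preserves cycles and boundaries. -/
def HomologyAt.map (α : M₂ →ₗ[A] M₂') (hα : ∀ x, g x = 0 → g' (α x) = 0)
    (hα' : ∀ x, ∃ y, f' y = α (f x)) : HomologyAt f g →ₗ[A] HomologyAt f' g' :=
  Submodule.mapQ _ _ (α.restrict hα) (by
    rintro ⟨x, hx⟩ ⟨w, rfl⟩
    exact hα' w)

end HomologyAt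

section Compare

open CategoryTheory

variable {R : Type u} [CommRing R] {B : Type u} [CommRing B] [Algebra R B]
  {P Q : ProjectiveResolution (ModuleCat.of R B)}

lemma hom_d_apply (f : P.complex ⟶ Q.complex) (i j : ℕ) (x : P.complex.X i) :
    (Q.complex.d i j).hom ((f.f i).hom x) = (f.f j).hom ((P.complex.d i j).hom x) :=
  congrArg (fun h => h.hom x) (f.comm i j)

variable (A : Type u) [CommRing A] [Algebra R A]

lemma tensorD_map (f : P.complex ⟶ Q.complex) (i j : ℕ) (x : A ⊗[R] P.complex.X i) :
    tensorD A Q i j ((f.f i).hom.baseChange A x) =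
      (f.f j).hom.baseChange A (tensorD A P i j x) := by
  induction x using TensorProduct.induction_on with
  | zero => simp
  | tmul a x => simp only [tensorD, LinearMap.baseChange_tmul, hom_d_apply]
  | add x y hx hy => simp only [map_add, hx, hy]

/-- The map on `Hₙ(A ⊗ -)` induced by a chain map between resolutions. -/
def tensorHomologyMap (f : P.complex ⟶ Q.complex) (n : ℕ) :
    tensorHomology A P n →ₗ[A] tensorHomology A Q n :=
  HomologyAt.map ((f.f n).hom.baseChange A)
    (fun x hx => by rw [tensorD_map, hx, map_zero]) (fun x => ⟨_, tensorD_map A f _ _ x⟩)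

lemma tensorHomologyMap_mk_eq (f : P.complex ⟶ Q.complex) (n : ℕ)
    {x : LinearMap.ker (tensorD A P n (n - 1))} {y : LinearMap.ker (tensorD A Q n (n - 1))}
    (h : ∃ w, tensorD A Q (n + 1) n w = (f.f n).hom.baseChange A x - y) :
    tensorHomologyMap A f n (HomologyAt.mk _ _ x) = HomologyAt.mk _ _ y :=
  HomologyAt.mk_eq_mk_iff.2 h

/-- The map on cycles induced by a chain map between resolutions. -/
def tensorCyclesMap (f : P.complex ⟶ Q.complex) (n : ℕ)
    (x : LinearMap.ker (tensorD A P n (n - 1))) :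
    LinearMap.ker (tensorD A Q n (n - 1)) :=
  ⟨(f.f n).hom.baseChange A x, by
    rw [LinearMap.mem_ker, tensorD_map, LinearMap.mem_ker.1 x.2, map_zero]⟩

/-- If `f ≫ g` is homotopic to the identity, then `g` is a left inverse of `f` on homology. -/
lemma tensorHomologyMap_comp_eq_id (f : P.complex ⟶ Q.complex) (g : Q.complex ⟶ P.complex)
    (h : Homotopy (f ≫ g) (𝟙 P.complex)) (n : ℕ) :
    tensorHomologyMap A g n ∘ₗ tensorHomologyMap A f n = LinearMap.id := by
  refine LinearMap.ext fun x => ?_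
  obtain ⟨x, rfl⟩ := HomologyAt.mk_surjective x
  refine HomologyAt.mk_eq_mk_iff.2 ⟨(h.hom n (n + 1)).hom.baseChange A x, ?_⟩
  have key : ∀ x : P.complex.X n, (g.f n).hom ((f.f n).hom x) =
      (h.hom (n - 1) n).hom ((P.complex.d n (n - 1)).hom x) +
        (P.complex.d (n + 1) n).hom ((h.hom n (n + 1)).hom x) + x := by
    intro x
    have := h.comm n
    rw [dNext_nat, Homotopy.prevD_chainComplex] at this
    exact congrArg (fun f => f.hom x) this
  have key' : ∀ x : A ⊗[R] P.complex.X n, (g.f n).hom.baseChange A ((f.f n).hom.baseChange A x) =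
      (h.hom (n - 1) n).hom.baseChange A (tensorD A P n (n - 1) x) +
        tensorD A P (n + 1) n ((h.hom n (n + 1)).hom.baseChange A x) + x := by
    intro x
    induction x using TensorProduct.induction_on with
    | zero => simp
    | tmul a x => simp only [tensorD, LinearMap.baseChange_tmul, key, TensorProduct.tmul_add]
    | add x y hx hy => simp only [map_add, hx, hy]; abel
  refine (eq_sub_of_add_eq ?_)
  refine Eq.trans ?_ (key' x).symm
  rw [LinearMap.mem_ker.1 x.2, map_zero, zero_add]

/-- The homologies of `A ⊗ P` and `A ⊗ Q` agree for resolutions `P` and `Q` of the same module. -/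
def tensorHomologyEquiv (P Q : ProjectiveResolution (ModuleCat.of R B)) (n : ℕ) :
    tensorHomology A P n ≃ₗ[A] tensorHomology A Q n :=
  LinearEquiv.ofLinearMap (tensorHomologyMap A (P.homotopyEquiv Q).hom n)
    (tensorHomologyMap A (P.homotopyEquiv Q).inv n)
    (tensorHomologyMap_comp_eq_id A _ _ (P.homotopyEquiv Q).homotopyInvHomId n)
    (tensorHomologyMap_comp_eq_id A _ _ (P.homotopyEquiv Q).homotopyHomInvId n)

end Compare

section Mul

open CategoryTheory

variable {R : Type u} [CommRing R] {B : Type u} [CommRing B] [Algebra R B]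
  {P Q : ProjectiveResolution (ModuleCat.of R B)}

/-- The deviation `f(x y) - f(x) f(y)` of a chain map from being multiplicative. -/
def mulDefect (F : MulLift P) (G : MulLift Q) (f : P.complex ⟶ Q.complex) (m n k : ℕ) :
    P.complex.X m →ₗ[R] P.complex.X n →ₗ[R] Q.complex.X k :=
  (F.μ m n k).compr₂ (f.f k).hom - (G.μ m n k).compl₁₂ (f.f m).hom (f.f n).hom

lemma mulDefect_apply (F : MulLift P) (G : MulLift Q) (f : P.complex ⟶ Q.complex) (m n k : ℕ)
    (x : P.complex.X m) (y : P.complex.X n) : mulDefect F G f m n k x y =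
      (f.f k).hom (F.μ m n k x y) - G.μ m n k ((f.f m).hom x) ((f.f n).hom y) := rfl

lemma d_mulDefect (F : MulLift P) (G : MulLift Q) (f : P.complex ⟶ Q.complex) (m n k : ℕ)
    (h : m + n = k + 1) (x : P.complex.X m) (y : P.complex.X n) :
    (Q.complex.d (k + 1) k).hom (mulDefect F G f m n (k + 1) x y) =
      mulDefect F G f (m - 1) n k ((P.complex.d m (m - 1)).hom x) y +
        (-1 : R) ^ m • mulDefect F G f m (n - 1) k x ((P.complex.d n (n - 1)).hom y) := by
  simp only [mulDefect_apply, map_sub, hom_d_apply, F.leibniz m n k h, G.leibniz m n k h, map_add,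
    map_smul, smul_sub]
  abel

/-- One level of a null-homotopy of the deviation of a chain map from being multiplicative. -/
def IsMulHomotopy (F : MulLift P) (G : MulLift Q) (f : P.complex ⟶ Q.complex) (k : ℕ)
    (h : ∀ m n : ℕ, P.complex.X m →ₗ[R] P.complex.X n →ₗ[R] Q.complex.X k)
    (g : ∀ m n : ℕ, P.complex.X m →ₗ[R] P.complex.X n →ₗ[R] Q.complex.X (k + 1)) : Prop :=
  ∀ m n, m + n = k → ∀ x y, (Q.complex.d (k + 1) k).hom (g m n x y) =
    mulDefect F G f m n k x y - (h (m - 1) n ((P.complex.d m (m - 1)).hom x) y +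
      (-1 : R) ^ m • h m (n - 1) x ((P.complex.d n (n - 1)).hom y))

variable (F : MulLift P) (G : MulLift Q) (f : P.complex ⟶ Q.complex)

/-- The next level of a null-homotopy exists when the prescribed boundaries are boundaries. -/
lemma exists_isMulHomotopy (k : ℕ)
    (h : ∀ m n : ℕ, P.complex.X m →ₗ[R] P.complex.X n →ₗ[R] Q.complex.X k)
    (H : ∀ m n, m + n = k → ∀ x y, ∃ z, (Q.complex.d (k + 1) k).hom z =
      mulDefect F G f m n k x y - (h (m - 1) n ((P.complex.d m (m - 1)).hom x) y +
        (-1 : R) ^ m • h m (n - 1) x ((P.complex.d n (n - 1)).hom y))) :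
    ∃ g, IsMulHomotopy F G f k h g := by
  have : ∀ m n, ∃ g : P.complex.X m →ₗ[R] P.complex.X n →ₗ[R] Q.complex.X (k + 1),
      m + n = k → ∀ x y, (Q.complex.d (k + 1) k).hom (g x y) =
        mulDefect F G f m n k x y - (h (m - 1) n ((P.complex.d m (m - 1)).hom x) y +
          (-1 : R) ^ m • h m (n - 1) x ((P.complex.d n (n - 1)).hom y)) := by
    intro m n
    by_cases hmn : m + n = k
    · obtain ⟨g, hg⟩ := exists_bilin_lift P m n (Q.complex.d (k + 1) k).hom
        (mulDefect F G f m n k - ((h (m - 1) n) ∘ₗ (P.complex.d m (m - 1)).hom +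
          (-1 : R) ^ m • (h m (n - 1)).compl₂ (P.complex.d n (n - 1)).hom)) (H m n hmn)
      exact ⟨g, fun _ => hg⟩
    · exact ⟨0, fun h => absurd h hmn⟩
  choose g hg using this
  exact ⟨g, hg⟩

lemma exists_isMulHomotopy_zero (hf : ∀ x, aug Q ((f.f 0).hom x) = aug P x) :
    ∃ g, IsMulHomotopy F G f 0 (fun _ _ => 0) g := by
  refine exists_isMulHomotopy F G f 0 _ fun m n hmn x y => exists_of_aug_eq_zero Q _ ?_
  obtain ⟨rfl, rfl⟩ : m = 0 ∧ n = 0 := by omega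
  simp only [LinearMap.zero_apply, smul_zero, add_zero, sub_zero, mulDefect_apply, map_sub, hf,
    F.aug_μ, G.aug_μ, sub_self]

lemma exists_isMulHomotopy_succ (k : ℕ)
    (h : ∀ m n : ℕ, P.complex.X m →ₗ[R] P.complex.X n →ₗ[R] Q.complex.X k)
    (g : ∀ m n : ℕ, P.complex.X m →ₗ[R] P.complex.X n →ₗ[R] Q.complex.X (k + 1))
    (hg : IsMulHomotopy F G f k h g) : ∃ l, IsMulHomotopy F G f (k + 1) g l := by
  refine exists_isMulHomotopy F G f (k + 1) g fun m n hmn x y => exists_of_d_eq_zero Q k _ ?_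
  have h1 : (Q.complex.d (k + 1) k).hom (g (m - 1) n ((P.complex.d m (m - 1)).hom x) y) =
      mulDefect F G f (m - 1) n k ((P.complex.d m (m - 1)).hom x) y +
        (-1 : R) ^ m • h (m - 1) (n - 1) ((P.complex.d m (m - 1)).hom x)
          ((P.complex.d n (n - 1)).hom y) := by
    cases m with
    | zero => simp only [d_self_apply, map_zero, LinearMap.zero_apply, smul_zero, add_zero]
    | succ m =>
      rw [hg _ _ (by simp; omega), d_d_apply, pow_succ]
      simp [sub_eq_add_neg]
  have h2 : (Q.complex.d (k + 1) k).hom (g m (n - 1) x ((P.complex.d n (n - 1)).hom y)) =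
      mulDefect F G f m (n - 1) k x ((P.complex.d n (n - 1)).hom y) -
        h (m - 1) (n - 1) ((P.complex.d m (m - 1)).hom x) ((P.complex.d n (n - 1)).hom y) := by
    cases n with
    | zero => simp only [d_self_apply, map_zero, sub_zero]
    | succ n =>
      rw [hg _ _ (by simp; omega), d_d_apply]
      simp
  rw [map_sub, map_add, map_smul, h1, h2, d_mulDefect F G f m n k hmn, smul_sub]
  abel

/-- A chain map over the identity of `B` is multiplicative up to homotopy. -/
lemma exists_mulHomotopy (hf : ∀ x, aug Q ((f.f 0).hom x) = aug P x) :
    ∃ h : ∀ k m n : ℕ, P.complex.X m →ₗ[R] P.complex.X n →ₗ[R] Q.complex.X k,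
      ∀ k, IsMulHomotopy F G f k (h k) (h (k + 1)) := by
  obtain ⟨g, hg⟩ := exists_isMulHomotopy_zero F G f hf
  choose next hnext using exists_isMulHomotopy_succ F G f
  let S : ∀ k, {p : (∀ m n : ℕ, P.complex.X m →ₗ[R] P.complex.X n →ₗ[R] Q.complex.X k) ×
      (∀ m n : ℕ, P.complex.X m →ₗ[R] P.complex.X n →ₗ[R] Q.complex.X (k + 1)) //
        IsMulHomotopy F G f k p.1 p.2} := fun k =>
    Nat.rec ⟨(_, g), hg⟩ (fun k p => ⟨(p.1.2, next k p.1.1 p.1.2 p.2), hnext k _ _ p.2⟩) k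
  exact ⟨fun k => (S k).1.1, fun k => (S k).2⟩

variable (A : Type u) [CommRing A] [Algebra R A]

lemma tensorD_bilinBaseChange {k : ℕ}
    {h : ∀ m n : ℕ, P.complex.X m →ₗ[R] P.complex.X n →ₗ[R] Q.complex.X k}
    {g : ∀ m n : ℕ, P.complex.X m →ₗ[R] P.complex.X n →ₗ[R] Q.complex.X (k + 1)}
    (hg : IsMulHomotopy F G f k h g) {m n : ℕ} (hmn : m + n = k)
    (x : A ⊗[R] P.complex.X m) (y : A ⊗[R] P.complex.X n) :
    tensorD A Q (k + 1) k (bilinBaseChange A (g m n) x y) =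
      (f.f k).hom.baseChange A (F.tensorMul A m n k x y) -
        G.tensorMul A m n k ((f.f m).hom.baseChange A x) ((f.f n).hom.baseChange A y) -
      (bilinBaseChange A (h (m - 1) n) (tensorD A P m (m - 1) x) y +
        (-1 : R) ^ m • bilinBaseChange A (h m (n - 1)) x (tensorD A P n (n - 1) y)) := by
  induction x using TensorProduct.induction_on with
  | zero => simp
  | tmul a x =>
    induction y using TensorProduct.induction_on with
    | zero => simp
    | tmul b y =>
      simp only [tensorD, MulLift.tensorMul, bilinBaseChange_tmul, LinearMap.baseChange_tmul,
        hg m n hmn, mulDefect_apply, TensorProduct.tmul_sub, TensorProduct.tmul_add,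
        TensorProduct.tmul_smul]
    | add c d hc hd => simp only [map_add, hc, hd, smul_add]; abel
  | add c d hc hd => simp only [map_add, LinearMap.add_apply, hc, hd, smul_add]; abel

lemma tensorHomologyMap_homologyMul (hf : ∀ x, aug Q ((f.f 0).hom x) = aug P x) (m n : ℕ)
    (x : tensorHomology A P m) (y : tensorHomology A P n) :
    tensorHomologyMap A f (m + n) (F.homologyMul A m n x y) =
      G.homologyMul A m n (tensorHomologyMap A f m x) (tensorHomologyMap A f n y) := by
  obtain ⟨h, hh⟩ := exists_mulHomotopy F G f hf
  obtain ⟨x, rfl⟩ := HomologyAt.mk_surjective x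
  obtain ⟨y, rfl⟩ := HomologyAt.mk_surjective y
  have key := tensorD_bilinBaseChange F G f A (hh (m + n)) rfl x.1 y.1
  rw [LinearMap.mem_ker.1 x.2, LinearMap.mem_ker.1 y.2, map_zero, map_zero,
    LinearMap.zero_apply, smul_zero, add_zero, sub_zero] at key
  have h1 := G.homologyMul_mk A m n (tensorCyclesMap A f m x) (tensorCyclesMap A f n y)
  have h2 := tensorHomologyMap_mk_eq A f (m + n) (x := F.cycleMul A m n x y)
    (y := G.cycleMul A m n (tensorCyclesMap A f m x) (tensorCyclesMap A f n y)) ⟨_, key⟩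
  exact h2.trans h1.symm

lemma tensorHomologyMap_homologyOne (hf : ∀ x, aug Q ((f.f 0).hom x) = aug P x) :
    tensorHomologyMap A f 0 (homologyOne A P) = homologyOne A Q := by
  obtain ⟨w, hw⟩ := exists_of_aug_eq_zero Q
    ((f.f 0).hom (aug_surjective P 1).choose - (aug_surjective Q 1).choose) (by
      rw [map_sub, hf, (aug_surjective P 1).choose_spec, (aug_surjective Q 1).choose_spec,
        sub_self])
  refine HomologyAt.mk_eq_mk_iff.2 ⟨1 ⊗ₜ w, ?_⟩
  refine (LinearMap.baseChange_tmul _ _ _).trans ?_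
  rw [hw, TensorProduct.tmul_sub]
  rfl

lemma aug_homotopyEquiv_hom (P Q : ProjectiveResolution (ModuleCat.of R B)) (x : P.complex.X 0) :
    aug Q (((P.homotopyEquiv Q).hom.f 0).hom x) = aug P x := by
  have h := HomologicalComplex.congr_hom (P.homotopyEquiv_hom_π Q) 0
  rw [aug, aug, ← h]
  rfl

end Mul

/-! ### Differential graded algebras as projective resolutions -/

section DGResolution

open CategoryTheory

variable {R : Type u} [CommRing R] {B : Type u} [CommRing B] [Algebra R B]

namespace DGAlg

/-- The underlying chain complex of a differential graded algebra. -/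
def complex (E : DGAlg.{u, u} R) : ChainComplex (ModuleCat.{u} R) ℕ :=
  ChainComplex.of (fun n => ModuleCat.of R (E.deg n))
    (fun n => ModuleCat.ofHom (E.d.restrict (E.d_mem n)))
    (fun n => by
      refine ModuleCat.hom_ext (LinearMap.ext fun x => Subtype.ext ?_)
      exact E.d_d x)

/-- A differential graded algebra `E` with an augmentation `ε` to an algebra `B` is a projective
resolution of `B`. -/
structure IsResolution (E : DGAlg.{u, u} R) (ε : E.carrier →ₐ[R] B) : Prop where
  projective : ∀ n, Module.Projective R (E.deg n)
  surjective : ∀ b, ∃ z ∈ E.deg 0, ε z = b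
  aug_d : ∀ y ∈ E.deg 1, ε (E.d y) = 0
  exact_zero : ∀ z ∈ E.deg 0, ε z = 0 → ∃ y ∈ E.deg 1, E.d y = z
  exact_succ : ∀ n, ∀ z ∈ E.deg (n + 1), E.d z = 0 → ∃ y ∈ E.deg (n + 2), E.d y = z

variable {E : DGAlg.{u, u} R} {ε : E.carrier →ₐ[R] B}

/-- The differential on the part of degree `n`. It is zero for `n = 0`. -/
def degD (E : DGAlg.{u, u} R) (n : ℕ) : E.deg n →ₗ[R] E.deg (n - 1) :=
  (E.d ∘ₗ (E.deg n).subtype).codRestrict _ fun x => by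
    cases n with
    | zero => exact (E.d_deg_zero x x.2).symm ▸ zero_mem _
    | succ n => exact E.d_mem n x x.2

lemma degD_zero : E.degD 0 = 0 :=
  LinearMap.ext fun x => Subtype.ext (E.d_deg_zero x x.2)

lemma complex_d_eq (n : ℕ) : E.complex.d n (n - 1) = ModuleCat.ofHom (E.degD n) := by
  cases n with
  | zero =>
    rw [degD_zero]
    exact E.complex.shape 0 0 (by simp)
  | succ n =>
    exact ChainComplex.of_d (fun n => ModuleCat.of R (E.deg n))
      (fun n => ModuleCat.ofHom (E.d.restrict (E.d_mem n))) n

lemma complex_d_apply (n : ℕ) (x : E.deg n) :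
    @Eq (E.deg (n - 1)) ((E.complex.d n (n - 1)).hom x) (E.degD n x) :=
  congrArg (fun f => f.hom x) (complex_d_eq n)

/-- The augmentation as a chain map. -/
def complexAug (h : E.IsResolution ε) :
    E.complex ⟶ (ChainComplex.single₀ (ModuleCat.{u} R)).obj (ModuleCat.of R B) :=
  (ChainComplex.toSingle₀Equiv _ _).symm
    ⟨ModuleCat.ofHom (ε.toLinearMap ∘ₗ (E.deg 0).subtype), by
      refine (congrArg (· ≫ _) (complex_d_eq 1)).trans
        (ModuleCat.hom_ext (LinearMap.ext fun x => ?_))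
      exact h.aug_d _ (Subtype.prop (p := (· ∈ E.deg 1)) x)⟩

lemma quasiIso_complexAug (h : E.IsResolution ε) : QuasiIso (complexAug h) where
  quasiIsoAt m := by
    cases m with
    | zero =>
      rw [ChainComplex.quasiIsoAt₀_iff, ShortComplex.quasiIso_iff_of_zeros' _ rfl rfl rfl]
      constructor
      · rw [ShortComplex.moduleCat_exact_iff]
        intro x hx
        obtain ⟨y, hy, hyx⟩ := h.exact_zero _ (Subtype.prop (p := (· ∈ E.deg 0)) x) hx
        refine ⟨⟨y, hy⟩, Subtype.ext ?_⟩
        exact (congrArg Subtype.val (complex_d_apply 1 ⟨y, hy⟩)).trans hyx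
      · rw [ModuleCat.epi_iff_surjective]
        intro b
        obtain ⟨z, hz, hzb⟩ := h.surjective b
        exact ⟨⟨z, hz⟩, hzb⟩
    | succ m =>
      rw [quasiIsoAt_iff_exactAt' (hL := ChainComplex.exactAt_succ_single_obj ..),
        HomologicalComplex.exactAt_iff' _ (m + 2) (m + 1) m (by simp) (by simp),
        ShortComplex.moduleCat_exact_iff]
      intro x hx
      obtain ⟨y, hy, hyx⟩ := h.exact_succ m _ (Subtype.prop (p := (· ∈ E.deg (m + 1))) x)
        (congrArg Subtype.val ((complex_d_apply (m + 1) x).symm.trans hx))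
      exact ⟨⟨y, hy⟩, Subtype.ext
        ((congrArg Subtype.val (complex_d_apply (m + 2) ⟨y, hy⟩)).trans hyx)⟩

/-- A differential graded algebra that resolves `B`, as a projective resolution. -/
def resolution (h : E.IsResolution ε) : ProjectiveResolution (ModuleCat.of R B) where
  complex := E.complex
  projective n := (IsProjective.iff_projective (R := R) (E.deg n)).1 (h.projective n)
  π := complexAug h
  quasiIso := quasiIso_complexAug h

/-- The multiplication of homogeneous elements, as a bilinear map to the part of degree `k`. It is
zero if the degrees do not add up to `k`. -/
def degMul (E : DGAlg.{u, u} R) (m n k : ℕ) : E.deg m →ₗ[R] E.deg n →ₗ[R] E.deg k :=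
  if h : m + n = k then
    LinearMap.mk₂ R (fun x y => ⟨x * y, h ▸ SetLike.mul_mem_graded x.2 y.2⟩)
      (fun _ _ _ => Subtype.ext (add_mul _ _ _)) (fun _ _ _ => Subtype.ext (smul_mul_assoc _ _ _))
      (fun _ _ _ => Subtype.ext (mul_add _ _ _)) (fun _ _ _ => Subtype.ext (mul_smul_comm _ _ _))
  else 0

lemma coe_degMul {m n k : ℕ} (h : m + n = k) (x : E.deg m) (y : E.deg n) :
    (E.degMul m n k x y : E.carrier) = x * y := by
  rw [degMul, dif_pos h]
  rfl

lemma degD_degMul (m n k : ℕ) (h : m + n = k + 1) (x : E.deg m) (y : E.deg n) :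
    E.degD (k + 1) (E.degMul m n (k + 1) x y) =
      E.degMul (m - 1) n k (E.degD m x) y + (-1 : R) ^ m • E.degMul m (n - 1) k x (E.degD n y) := by
  have h1 : (E.degMul (m - 1) n k (E.degD m x) y : E.carrier) = E.d x * y := by
    cases m with
    | zero => rw [E.d_deg_zero x x.2, degD_zero]; simp
    | succ m => exact coe_degMul (by omega) _ _
  have h2 : (E.degMul m (n - 1) k x (E.degD n y) : E.carrier) = x * E.d y := by
    cases n with
    | zero => rw [E.d_deg_zero y y.2, degD_zero]; simp
    | succ n => exact coe_degMul (by omega) _ _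
  refine Subtype.ext ?_
  refine (congrArg E.d (coe_degMul h x y)).trans ?_
  rw [E.leibniz m _ _ x.2, ← h1, ← h2]
  rfl

/-- The multiplication of a differential graded algebra that resolves `B` lifts the multiplication
of `B`. -/
def mulLift (h : E.IsResolution ε) : MulLift (resolution h) where
  μ := E.degMul
  shape m n k hk := dif_neg hk
  aug_μ x y := (congrArg ε (coe_degMul (E := E) (m := 0) (n := 0) (k := 0) rfl x y)).trans
    (map_mul ε _ _)
  leibniz m n k hk x y := by
    refine (complex_d_apply (k + 1) (E.degMul m n (k + 1) x y)).trans
      ((degD_degMul m n k hk x y).trans ?_)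
    exact (congrArg₂ (fun (a : E.deg (m - 1)) (b : E.deg (n - 1)) => E.degMul (m - 1) n k a y +
      (-1 : R) ^ m • E.degMul m (n - 1) k x b) (complex_d_apply m x) (complex_d_apply n y)).symm

end DGAlg
end DGResolution

/-! ### Homology algebras and `Tor` -/

namespace DGAlg

section Incl

open CategoryTheory

variable {R : Type u} [CommRing R] {B : Type u} [CommRing B] [Algebra R B]
  {E : DGAlg.{u, u} R} {ε : E.carrier →ₐ[R] B} (h : E.IsResolution ε)

/-- The projection onto the part of degree `n`. -/
def degProj (n : ℕ) : E.carrier →ₗ[R] (resolution h).complex.X n :=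
  DirectSum.component R ℕ (fun i => E.deg i) n ∘ₗ
    (DirectSum.decomposeLinearEquiv E.deg).toLinearMap

/-- The inclusion of the part of degree `n`. -/
def degIncl (n : ℕ) : (resolution h).complex.X n →ₗ[R] E.carrier := (E.deg n).subtype

lemma degProj_degIncl (n : ℕ) : degProj h n ∘ₗ degIncl h n = LinearMap.id :=
  LinearMap.ext fun x => Subtype.ext (DirectSum.decompose_of_mem_same E.deg
    (Subtype.prop (p := (· ∈ E.deg n)) x))

lemma degIncl_d (n : ℕ) (x : (resolution h).complex.X n) :
    degIncl h (n - 1) (((resolution h).complex.d n (n - 1)).hom x) = E.d (degIncl h n x) :=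
  congrArg Subtype.val (complex_d_apply n x)

lemma degIncl_mul (m n : ℕ) (x : (resolution h).complex.X m) (y : (resolution h).complex.X n) :
    degIncl h (m + n) ((mulLift h).μ m n (m + n) x y) = degIncl h m x * degIncl h n y :=
  coe_degMul rfl _ _

variable (A : Type u) [CommRing A] [Algebra R A]

/-- The map from `A ⊗ Eₙ` to `A ⊗ E`. -/
def tensorIncl (n : ℕ) : A ⊗[R] (resolution h).complex.X n →ₗ[A] (E.baseChange A).carrier :=
  (degIncl h n).baseChange A

lemma tensorIncl_tmul (n : ℕ) (a : A) (x : (resolution h).complex.X n) :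
    tensorIncl h A n (a ⊗ₜ x) = a ⊗ₜ[R] degIncl h n x := rfl

lemma tensorIncl_injective (n : ℕ) : Function.Injective (tensorIncl h A n) := by
  refine Function.LeftInverse.injective (g := (degProj h n).baseChange A) fun x => ?_
  refine (LinearMap.congr_fun (LinearMap.baseChange_comp (A := A) (f := degIncl h n)
    (degProj h n)) x).symm.trans ?_
  rw [degProj_degIncl, LinearMap.baseChange_id, LinearMap.id_apply]

lemma tensorIncl_mem (n : ℕ) (x : A ⊗[R] (resolution h).complex.X n) :
    tensorIncl h A n x ∈ (E.baseChange A).deg n := ⟨x, rfl⟩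

lemma exists_tensorIncl_eq (n : ℕ) {z : (E.baseChange A).carrier}
    (hz : z ∈ (E.baseChange A).deg n) : ∃ x, tensorIncl h A n x = z := hz

lemma tensorIncl_tensorD (n : ℕ) (x : A ⊗[R] (resolution h).complex.X n) :
    tensorIncl h A (n - 1) (tensorD A (resolution h) n (n - 1) x) =
      (E.baseChange A).d (tensorIncl h A n x) := by
  induction x using TensorProduct.induction_on with
  | zero => rw [map_zero, map_zero, map_zero, map_zero]
  | tmul a x =>
    rw [tensorD, LinearMap.baseChange_tmul, tensorIncl_tmul, degIncl_d]
    rfl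
  | add x y hx hy => rw [map_add, map_add, map_add, map_add, hx, hy]

lemma tensorIncl_tensorMul (m n : ℕ) (x : A ⊗[R] (resolution h).complex.X m)
    (y : A ⊗[R] (resolution h).complex.X n) :
    tensorIncl h A (m + n) ((mulLift h).tensorMul A m n (m + n) x y) =
      tensorIncl h A m x * tensorIncl h A n y := by
  induction x using TensorProduct.induction_on with
  | zero => rw [map_zero, LinearMap.zero_apply, map_zero, map_zero, zero_mul]
  | tmul a x =>
    induction y using TensorProduct.induction_on with
    | zero => rw [map_zero, map_zero, map_zero, mul_zero]
    | tmul b y =>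
      rw [MulLift.tensorMul, bilinBaseChange_tmul, tensorIncl_tmul, degIncl_mul]
      exact (Algebra.TensorProduct.tmul_mul_tmul _ _ _ _).symm
    | add c d hc hd => rw [map_add, map_add, map_add, mul_add, hc, hd]
  | add c d hc hd => rw [map_add, LinearMap.add_apply, map_add, map_add, add_mul, hc, hd]

end Incl

section Homology

open CategoryTheory

variable {R : Type u} [CommRing R] {B : Type u} [CommRing B] [Algebra R B]
  {E : DGAlg.{u, u} R} {ε : E.carrier →ₐ[R] B} (h : E.IsResolution ε)
  (A : Type u) [CommRing A] [Algebra R A]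

/-- The map from cycles of degree `n` in the complex `A ⊗ E` to cycles of the algebra `A ⊗ E`. -/
def toCycles (n : ℕ) : LinearMap.ker (tensorD A (resolution h) n (n - 1)) →ₗ[A]
    (E.baseChange A).cycles where
  toFun x := ⟨tensorIncl h A n x, by
    rw [mem_cycles, ← tensorIncl_tensorD h A n, LinearMap.mem_ker.1 x.2, map_zero]⟩
  map_add' x y := Subtype.ext (map_add (tensorIncl h A n) _ _)
  map_smul' a x := Subtype.ext (map_smul (tensorIncl h A n) _ _)

lemma coe_toCycles (n : ℕ) (x : LinearMap.ker (tensorD A (resolution h) n (n - 1))) :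
    (toCycles h A n x : (E.baseChange A).carrier) = tensorIncl h A n x := rfl

lemma toCycles_mem (n : ℕ) (x : LinearMap.ker (tensorD A (resolution h) n (n - 1))) :
    (toCycles h A n x : (E.baseChange A).carrier) ∈ (E.baseChange A).deg n :=
  tensorIncl_mem h A n x

variable {A} in
/-- The class of a cycle in the homology algebra. -/
def homologyMk (F : DGAlg.{u, u} A) : F.cycles →ₐ[A] F.Homology :=
  Ideal.Quotient.mkₐ A F.boundaries

variable {A} in
lemma homologyMk_eq_zero_iff (F : DGAlg.{u, u} A) (z : F.cycles) :
    homologyMk F z = 0 ↔ ∃ w, F.d w = z :=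
  Ideal.Quotient.eq_zero_iff_mem

/-- The map from the homology of the complex `A ⊗ E` in degree `n` to the homology algebra. -/
def toHomology (n : ℕ) : tensorHomology A (resolution h) n →ₗ[A] (E.baseChange A).Homology :=
  Submodule.liftQ _ ((homologyMk (E.baseChange A)).toLinearMap ∘ₗ toCycles h A n) (by
    rintro ⟨x, hx⟩ ⟨w, rfl⟩
    exact (homologyMk_eq_zero_iff _ _).2
      ⟨tensorIncl h A (n + 1) w, (tensorIncl_tensorD h A (n + 1) w).symm⟩)

lemma toHomology_mk (n : ℕ) (x : LinearMap.ker (tensorD A (resolution h) n (n - 1))) :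
    toHomology h A n (HomologyAt.mk _ _ x) =
      homologyMk (E.baseChange A) (toCycles h A n x) := rfl

lemma exists_toCycles_eq {n : ℕ} {z : (E.baseChange A).cycles}
    (hz : (z : (E.baseChange A).carrier) ∈ (E.baseChange A).deg n) :
    ∃ x, toCycles h A n x = z := by
  obtain ⟨x, hx⟩ := exists_tensorIncl_eq h A n hz
  refine ⟨⟨x, LinearMap.mem_ker.2 (tensorIncl_injective h A _ ?_)⟩, Subtype.ext hx⟩
  rw [map_zero, tensorIncl_tensorD h A n, hx, (E.baseChange A).mem_cycles.1 z.2]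

lemma range_toHomology (n : ℕ) :
    LinearMap.range (toHomology h A n) = (E.baseChange A).homologyDeg n := by
  ext y
  constructor
  · rintro ⟨x, rfl⟩
    obtain ⟨x, rfl⟩ := HomologyAt.mk_surjective x
    exact ⟨toCycles h A n x, toCycles_mem h A n x, rfl⟩
  · rintro ⟨z, hz, rfl⟩
    obtain ⟨x, hx⟩ := exists_toCycles_eq h A (n := n) (z := z) hz
    exact ⟨HomologyAt.mk _ _ x,
      (toHomology_mk h A n x).trans (congrArg (homologyMk (E.baseChange A)) hx)⟩

lemma toHomology_homologyMul (m n : ℕ) (x : tensorHomology A (resolution h) m)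
    (y : tensorHomology A (resolution h) n) :
    toHomology h A (m + n) ((mulLift h).homologyMul A m n x y) =
      toHomology h A m x * toHomology h A n y := by
  obtain ⟨x, rfl⟩ := HomologyAt.mk_surjective x
  obtain ⟨y, rfl⟩ := HomologyAt.mk_surjective y
  rw [toHomology_mk, toHomology_mk, ← map_mul]
  refine (toHomology_mk h A (m + n) ((mulLift h).cycleMul A m n x y)).trans (congrArg _ ?_)
  exact Subtype.ext (tensorIncl_tensorMul h A m n x y)

lemma toHomology_homologyOne : toHomology h A 0 (homologyOne A (resolution h)) = 1 := by
  let e : E.deg 0 := (aug_surjective (resolution h) 1).choose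
  have he : ε e = 1 := (aug_surjective (resolution h) 1).choose_spec
  obtain ⟨y, hy, hyd⟩ := h.exact_zero (e - 1) (sub_mem e.2 SetLike.GradedOne.one_mem)
    (by rw [map_sub, he, map_one, sub_self])
  rw [← map_one (homologyMk (E.baseChange A)), ← sub_eq_zero, homologyOne, toHomology_mk, ← map_sub,
    homologyMk_eq_zero_iff]
  exact ⟨(1 : A) ⊗ₜ[R] y, (congrArg ((1 : A) ⊗ₜ[R] ·) hyd).trans (TensorProduct.tmul_sub _ _ _)⟩

/-- The sum over all degrees of the maps to the homology algebra is injective: the components of a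
boundary are boundaries. -/
lemma toModule_toHomology_injective :
    Function.Injective (DirectSum.toModule A ℕ _ (toHomology h A)) := by
  classical
  rw [injective_iff_map_eq_zero]
  intro v hv
  choose x hx using fun n => HomologyAt.mk_surjective (v n)
  rw [← DirectSum.sum_support_of v, map_sum] at hv
  have h1 : ∀ n, DirectSum.toModule A ℕ _ (toHomology h A) (DirectSum.of _ n (v n)) =
      homologyMk (E.baseChange A) (toCycles h A n (x n)) := fun n => by
    rw [← toHomology_mk, hx]
    exact DirectSum.toModule_lof A n (v n)
  simp only [h1] at hv
  rw [← map_sum, homologyMk_eq_zero_iff] at hv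
  obtain ⟨w, hw⟩ := hv
  refine DFinsupp.ext fun n => ?_
  by_cases hn : n ∈ DFinsupp.support v
  swap
  · exact DFinsupp.notMem_support_iff.1 hn
  have h2 := decompose_map_apply (E.baseChange A).deg (E.baseChange A).d (E.baseChange A).d_mem
    (E.baseChange A).d_deg_zero w n
  rw [hw, AddSubmonoidClass.coe_finsetSum, DirectSum.decompose_sum, DFinsupp.finsetSum_apply,
    AddSubmonoidClass.coe_finsetSum, Finset.sum_eq_single n
      (fun i _ hi => DirectSum.decompose_of_mem_ne (E.baseChange A).deg
        (toCycles_mem h A i (x i)) hi)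
      (fun hn' => absurd hn hn'),
    DirectSum.decompose_of_mem_same _ (toCycles_mem h A n (x n)), coe_toCycles] at h2
  obtain ⟨w', hw'⟩ := exists_tensorIncl_eq h A (n + 1)
    (SetLike.coe_mem (DirectSum.decompose (E.baseChange A).deg w (n + 1)))
  rw [← hx n]
  refine (Submodule.Quotient.mk_eq_zero _).2 ⟨w', tensorIncl_injective h A n ?_⟩
  rw [← hw', ← tensorIncl_tensorD] at h2
  exact h2.symm

/-- The sum over all degrees of the maps to the homology algebra is surjective: the components of a
cycle are cycles. -/
lemma toModule_toHomology_surjective :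
    Function.Surjective (DirectSum.toModule A ℕ _ (toHomology h A)) := by
  classical
  intro z
  obtain ⟨z, rfl⟩ := Ideal.Quotient.mk_surjective z
  have hc : ∀ n, (E.baseChange A).d (DirectSum.decompose (E.baseChange A).deg z.1 n) = 0 := by
    intro n
    cases n with
    | zero => exact (E.baseChange A).d_deg_zero _ (SetLike.coe_mem _)
    | succ n =>
      rw [← decompose_map_apply (E.baseChange A).deg (E.baseChange A).d (E.baseChange A).d_mem
        (E.baseChange A).d_deg_zero, (E.baseChange A).mem_cycles.1 z.2, DirectSum.decompose_zero]
      rfl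
  choose x hx using fun n => exists_toCycles_eq h A (z := ⟨_, hc n⟩)
    (SetLike.coe_mem (DirectSum.decompose (E.baseChange A).deg z.1 n))
  refine ⟨∑ n ∈ (DirectSum.decompose (E.baseChange A).deg z.1).support,
    DirectSum.lof A ℕ _ n (HomologyAt.mk _ _ (x n)), ?_⟩
  rw [map_sum]
  simp only [DirectSum.toModule_lof, toHomology_mk, hx]
  rw [← map_sum]
  refine congrArg (homologyMk (E.baseChange A)) (Subtype.ext ?_)
  rw [AddSubmonoidClass.coe_finsetSum]
  exact DirectSum.sum_support_decompose (E.baseChange A).deg z.1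

/-- The homology in degree `n` of `A ⊗ P`, for the chosen resolution `P` of `B`, in the homology
algebra of `A ⊗ E`. -/
def torToHomology (n : ℕ) : Tor R A B n →ₗ[A] (E.baseChange A).Homology :=
  toHomology h A n ∘ₗ (tensorHomologyEquiv A (projectiveResolution (ModuleCat.of R B))
    (resolution h) n).toLinearMap

lemma torToHomology_torMul (m n : ℕ) (x : Tor R A B m) (y : Tor R A B n) :
    torToHomology h A (m + n) (torMul R A B m n x y) =
      torToHomology h A m x * torToHomology h A n y :=
  (congrArg (toHomology h A (m + n)) (tensorHomologyMap_homologyMul _ (mulLift h) _ A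
    (aug_homotopyEquiv_hom _ _) m n x y)).trans (toHomology_homologyMul h A m n _ _)

lemma torToHomology_one :
    torToHomology h A 0 (homologyOne A (projectiveResolution (ModuleCat.of R B))) = 1 :=
  (congrArg (toHomology h A 0) (tensorHomologyMap_homologyOne _ A
    (aug_homotopyEquiv_hom _ _))).trans (toHomology_homologyOne h A)

lemma range_torToHomology (n : ℕ) :
    LinearMap.range (torToHomology h A n) = (E.baseChange A).homologyDeg n := by
  rw [← range_toHomology h A n]
  exact LinearMap.range_comp_of_range_eq_top _ (LinearEquiv.range _)

/-- The isomorphism from `Tor(A, B)` to the homology algebra of `A ⊗ E` for a differential graded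
algebra `E` that resolves `B`. -/
def torEquiv : TorAlg R A B ≃ₗ[A] (E.baseChange A).Homology :=
  (DFinsupp.mapRange.linearEquiv fun n => tensorHomologyEquiv A
    (projectiveResolution (ModuleCat.of R B)) (resolution h) n) ≪≫ₗ
  LinearEquiv.ofBijective (DirectSum.toModule A ℕ _ (toHomology h A))
    ⟨toModule_toHomology_injective h A, toModule_toHomology_surjective h A⟩

lemma torEquiv_of (n : ℕ) (x : Tor R A B n) :
    torEquiv h A (DirectSum.of (Tor R A B) n x) = torToHomology h A n x := by
  refine (congrArg (DirectSum.toModule A ℕ _ (toHomology h A)) (DFinsupp.mapRange_single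
    (f := fun n => tensorHomologyEquiv A (projectiveResolution (ModuleCat.of R B))
      (resolution h) n) (hf := fun n => map_zero _))).trans ?_
  exact DirectSum.toModule_lof A n _

lemma torEquiv_mul (x y : TorAlg R A B) :
    torEquiv h A (x * y) = torEquiv h A x * torEquiv h A y := by
  induction x using DirectSum.induction_on with
  | zero => rw [zero_mul, map_zero, zero_mul]
  | of m x =>
    induction y using DirectSum.induction_on with
    | zero => rw [mul_zero, map_zero, mul_zero]
    | of n y =>
      rw [DirectSum.of_mul_of, torEquiv_of, torEquiv_of, torEquiv_of]
      exact torToHomology_torMul h A m n x y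
    | add y z hy hz => rw [mul_add, map_add, map_add, mul_add, hy, hz]
  | add x z hx hz => rw [add_mul, map_add, map_add, add_mul, hx, hz]

lemma torEquiv_one : torEquiv h A 1 = 1 :=
  (torEquiv_of h A 0 _).trans (torToHomology_one h A)

lemma map_torEquiv_range_lof (n : ℕ) :
    (LinearMap.range (DirectSum.lof A ℕ (Tor R A B) n)).map (torEquiv h A).toLinearMap =
      (E.baseChange A).homologyDeg n := by
  rw [← range_torToHomology h A n, ← LinearMap.range_comp]
  exact congrArg LinearMap.range (LinearMap.ext fun x => torEquiv_of h A n x)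

end Homology
end DGAlg

section KoszulPow

variable {R : Type u} [CommRing R] {N : ℕ∞} {u : {i : ℕ // (i : ℕ∞) < N} → R}

/-- For a regular sequence, `K(R; Iˢ)` is a projective resolution of `R / Iˢ`. -/
lemma koszulPow_isResolution (hu : IsRegularSeq u) (s : ℕ) :
    (koszulPow u s).IsResolution (koszulAug u s) where
  projective := koszulPow_deg_projective u s
  surjective := koszulAug_surjective u s
  aug_d := fun _ => koszulAug_d u s
  exact_zero := fun _ => koszulPow_exact_zero u s
  exact_succ := fun n _ => koszulPow_exact_succ s hu n

end KoszulPow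

end

end RegularQuotient

theorem mainTheorem3 {R : Type u} [CommRing R] {N : ℕ∞} (u : {i : ℕ // (i : ℕ∞) < N} → R)
    (hu : RegularQuotient.IsRegularSeq u) (I : Ideal R) (hI : I = Ideal.span (Set.range u))
    (s : ℕ) (hs : 1 ≤ s) :
    ∃ φ : RegularQuotient.TorAlg R (R ⧸ I) (R ⧸ I ^ s) ≃ₗ[R ⧸ I]
        ((RegularQuotient.koszulPow u s).baseChange (R ⧸ I)).Homology,
      (∀ n, (LinearMap.range (DirectSum.lof (R ⧸ I) ℕ
          (RegularQuotient.Tor R (R ⧸ I) (R ⧸ I ^ s)) n)).map φ.toLinearMap =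
        ((RegularQuotient.koszulPow u s).baseChange (R ⧸ I)).homologyDeg n) ∧
      φ 1 = 1 ∧ ∀ x y, φ (x * y) = φ x * φ y := by
  subst hI
  have h := RegularQuotient.koszulPow_isResolution hu s
  exact ⟨RegularQuotient.DGAlg.torEquiv h _, RegularQuotient.DGAlg.map_torEquiv_range_lof h _,
    RegularQuotient.DGAlg.torEquiv_one h _, RegularQuotient.DGAlg.torEquiv_mul h _⟩
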